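/- Let $n\ge 3$ be an integer and let $p$ be an odd prime such that the class of $2$ generates the unit group $U(\mathbb{Z}_{p^2})$ of $\mathbb{Z}/p^2\mathbb{Z}$. Let $G=\langle a\rangle\times\langle b\rangle$ be an abelian group with $o(a)=p^n$ and $o(b)=p$ (so $G\cong C_{p^n}\times C_p$). A minimal code of $\mathbb{F}_2G$ is a minimal nonzero ideal of $\mathbb{F}_2G$; its dimension is its dimension over $\mathbb{F}_2$, and its weight is the minimum number of nonzero coefficients of its nonzero elements. Two ideals are $G$-equivalent if the linear extension to $\mathbb{F}_2G$ of some automorphism of $G$ maps the one onto the other. For a subgroup $H\le G$ put $\widehat H=\frac{1}{|H|}\sum_{h\in H}h\in\mathbb{F}_2G$, for $x\in G$ put $\widehat x=\widehat{\langle x\rangle}$, and let $(e)$ denote the ideal generated by $e$. Then the minimal codes of $\mathbb{F}_2G$ are exactly the following: 1. $I_0=(\widehat G)$, of dimension $1$ and weight $p^{n+1}$; 2. $I_k=\bigl(\widehat{\langle a^{p^k}\rangle\times\langle b\rangle}-\widehat{\langle a^{p^{k-1}}\rangle\times\langle b\rangle}\bigr)$ for $1\le k\le n$, of dimension $p^{k-1}(p-1)$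 and weight $2p^{n-k+1}$; 3. $I_{1i}=\bigl(\widehat{ab^i}-\widehat G\bigr)$ for $0\le i\le p-1$, of dimension $p-1$ and weight $2p^n$; 4. $I_{ki}=\bigl(\widehat{a^{p^{k-1}}b^i}-\widehat{\langle a^{p^{k-1}}\rangle\times\langle b\rangle}\bigr)$ for $2\le k\le n$ and $1\le i\le p-1$, of dimension $p^{k-1}(p-1)$ and weight $2p^{n-k+1}$. There are exactly $2n$ $G$-equivalence classes of minimal codes of $\mathbb{F}_2G$. In particular, $G$ is a finite abelian group of odd order for which the number of $G$-equivalence classes of minimal codes of $\mathbb{F}_2G$ differs from the number $\tau(m)$ of positive divisors of the exponent $m$ of $G$, so $G$ is a counterexample to the assertion (Miller's Theorem A) that for every finite abelian group of odd order these two numbers are equal. -/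

import Mathlib

/-- A code of length `|G|` in the group algebra: an ideal of `F[G]`. -/
abbrev GroupCode (F G : Type*) [Field F] [CommGroup G] : Type _ :=
  Ideal (MonoidAlgebra F G)

/-- The element `|H|⁻¹ ∑_{h ∈ H} h` of the group algebra, for a (finite) subgroup `H`. -/
noncomputable def subgroupHat (F : Type*) {G : Type*} [Field F] [CommGroup G]
    (H : Subgroup G) : MonoidAlgebra F G :=
  (Nat.card H : F)⁻¹ • ∑ᶠ h : H, MonoidAlgebra.of F G (h : G)

/-- A minimal code: a minimal nonzero ideal of the group algebra. -/
def IsMinimalCode {F G : Type*} [Field F] [CommGroup G] (I : GroupCode F G) : Prop :=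
  IsAtom I

/-- Two codes are `G`-equivalent if the linear extension of some automorphism of the group `G`
maps the first onto the second. -/
def GEquivalent {F G : Type*} [Field F] [CommGroup G] (I J : GroupCode F G) : Prop :=
  ∃ ψ : G ≃* G, MonoidAlgebra.domCongr F F ψ '' (I : Set (MonoidAlgebra F G)) = J

/-- The number of nonzero coefficients of an element of the group algebra. -/
noncomputable def hammingWeight {F G : Type*} [Field F] [CommGroup G]
    (x : MonoidAlgebra F G) : ℕ :=
  x.coeff.support.card

/-- The weight of the code `I` is `w`: the minimum of the Hamming weights of the nonzero elements
of `I` is attained and equals `w`. -/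
def HasCodeWeight {F G : Type*} [Field F] [CommGroup G] (I : GroupCode F G) (w : ℕ) : Prop :=
  IsLeast {m : ℕ | ∃ x ∈ I, x ≠ 0 ∧ hammingWeight x = m} w

theorem GEquivalent.equivalence (F G : Type*) [Field F] [CommGroup G] :
    Equivalence (GEquivalent (F := F) (G := G)) where
  refl I := ⟨MulEquiv.refl G, by simp⟩
  symm := by
    rintro I J ⟨ψ, h⟩
    refine ⟨ψ.symm, ?_⟩
    rw [← h, ← MonoidAlgebra.domCongr_symm, Set.image_image]
    exact (Set.image_congr fun x _ =>
      (MonoidAlgebra.domCongr F F ψ).symm_apply_apply x).trans (Set.image_id' _)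
  trans := by
    rintro I J K ⟨ψ, h⟩ ⟨φ, h'⟩
    refine ⟨ψ.trans φ, ?_⟩
    rw [← h', ← h, Set.image_image]
    refine Set.image_congr fun x _ => ?_
    ext g
    simp

/-- `G`-equivalence as an equivalence relation on the set of minimal codes of `F[G]`. -/
def minimalCodeSetoid (F G : Type*) [Field F] [CommGroup G] :
    Setoid {I : GroupCode F G // IsMinimalCode I} :=
  ⟨fun I J => GEquivalent I.1 J.1,
    (GEquivalent.equivalence F G).comap Subtype.val⟩

/-- The number of `G`-equivalence classes of minimal codes of `F[G]`. -/
noncomputable def numMinimalCodeClasses (F G : Type*) [Field F] [CommGroup G] : ℕ :=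
  Nat.card (Quotient (minimalCodeSetoid F G))

/-- The code generated by `Ĥ`, where `H` is the whole group. -/
noncomputable def codeZero (G : Type*) [CommGroup G] : GroupCode (ZMod 2) G :=
  Ideal.span {subgroupHat (ZMod 2) (⊤ : Subgroup G)}

/-- The code generated by `Ĥ - K̂`, where `H = ⟨a ^ p ^ k⟩⟨b⟩` and `K = ⟨a ^ p ^ (k - 1)⟩⟨b⟩`
(used for `k ≥ 1`). -/
noncomputable def codeK {G : Type*} [CommGroup G] (p : ℕ) (a b : G) (k : ℕ) :
    GroupCode (ZMod 2) G :=
  Ideal.span {subgroupHat (ZMod 2) (Subgroup.zpowers (a ^ p ^ k) ⊔ Subgroup.zpowers b) -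
    subgroupHat (ZMod 2) (Subgroup.zpowers (a ^ p ^ (k - 1)) ⊔ Subgroup.zpowers b)}

/-- The code generated by `Ĥ - K̂`, where `H = ⟨a ^ p ^ (k - 1) * b ^ i⟩` and
`K = ⟨a ^ p ^ (k - 1)⟩⟨b⟩` (used for `k ≥ 1`). -/
noncomputable def codeKI {G : Type*} [CommGroup G] (p : ℕ) (a b : G) (k i : ℕ) :
    GroupCode (ZMod 2) G :=
  Ideal.span {subgroupHat (ZMod 2) (Subgroup.zpowers (a ^ p ^ (k - 1) * b ^ i)) -
    subgroupHat (ZMod 2) (Subgroup.zpowers (a ^ p ^ (k - 1)) ⊔ Subgroup.zpowers b)}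

/-!
Let `G` be a finite abelian `p`-group and `F` a field in which `p ≠ 0` and over which the cyclotomic
polynomials `Φ_d`, for `d` dividing the exponent of `G`, are irreducible. A minimal ideal `I` of
`F[G]` is determined by the kernel `H` of the action of `G` on it. The group `G ⧸ H` embeds into the
units of the field `F[G] ⧸ Ann(I)`, so it is cyclic. Conversely, if `G ⧸ H` is cyclic of order
`p ^ k > 1`, generated by the class of `x`, and `K / H` is its subgroup of order `p`, then
`Φ_{p ^ k}(x)` kills `Ĥ - K̂`, so that the ideal generated by `Ĥ - K̂` is isomorphic to the field
`F[X] ⧸ (Φ_{p ^ k})`: it is minimal, and its dimension is `φ(p ^ k)`. Its elements are constant on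
the cosets of `H` with coefficients of sum zero, so a nonzero one has at least two cosets in its
support, which gives the weight `2 * |H|`.

Two minimal ideals are `G`-equivalent if and only if some automorphism of `G` maps the one kernel
onto the other. For `G` of type `(p ^ n, p)` this leaves `2 * n` orbits of subgroups with cyclic
quotient: a noncyclic one for each index `p ^ k` with `k < n`, and a cyclic one for each index
`p ^ k` with `1 ≤ k ≤ n`.

Over `F_2` the irreducibility holds because a generator of the units modulo `p ^ 2`, for `p` odd,
generates the units modulo every power of `p`, and the irreducible factors of `Φ_m` have the order
of `2` modulo `m` as their degree.
-/

section Cyclotomic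

theorem zpowers_eq_top_of_zpowers_map_eq_top {C D : Type*} [Group C] [Group D] [IsCyclic C]
    [Finite C] {f : C →* D} (hf : Function.Surjective f)
    (hprime : ∀ q : ℕ, q.Prime → q ∣ Nat.card C → q ∣ Nat.card D) {g : C}
    (hg : Subgroup.zpowers (f g) = ⊤) : Subgroup.zpowers g = ⊤ := by
  obtain ⟨c, hc⟩ := IsCyclic.exists_generator (α := C)
  obtain ⟨m, rfl⟩ := mem_powers_iff_mem_zpowers.2 (hc g)
  have := Finite.of_surjective f hf
  have hcD : (Nat.card D).Coprime m := by
    have hd := orderOf_eq_card_of_zpowers_eq_top hg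
    have hfc : orderOf (f c) = Nat.card D :=
      Nat.dvd_antisymm (orderOf_dvd_natCard _) (hd ▸ map_pow f c m ▸ orderOf_pow_dvd m)
    rw [map_pow, orderOf_pow, hfc, Nat.div_eq_self] at hd
    exact hd.resolve_left Nat.card_pos.ne'
  have hcC : (orderOf c).Coprime m := by
    rw [orderOf_eq_card_of_forall_mem_zpowers hc]
    exact Nat.coprime_of_dvd fun q hq hqC => hq.coprime_iff_not_dvd.1 <|
      hcD.coprime_dvd_left (hprime q hq hqC)
  refine Subgroup.eq_top_of_card_eq _ ?_
  rw [Nat.card_zpowers, hcC.orderOf_pow, orderOf_eq_card_of_forall_mem_zpowers hc]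

theorem zpowers_unitOfCoprime_prime_pow_eq_top {p q : ℕ} (hp : p.Prime) (hp2 : p ≠ 2)
    (hqp : q.Coprime p)
    (hgen : Subgroup.zpowers (ZMod.unitOfCoprime q (hqp.pow_right 2)) = ⊤) (k : ℕ) :
    Subgroup.zpowers (ZMod.unitOfCoprime q (hqp.pow_right k)) = ⊤ := by
  have (j : ℕ) : NeZero (p ^ j) := ⟨pow_ne_zero j hp.ne_zero⟩
  have hunitsMap {m : ℕ} (hm : m ≤ k + 2) :
      ZMod.unitsMap (pow_dvd_pow p hm) (ZMod.unitOfCoprime q (hqp.pow_right (k + 2))) =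
        ZMod.unitOfCoprime q (hqp.pow_right m) :=
    Units.ext (ZMod.cast_natCast (pow_dvd_pow p hm) q)
  have hcyc := ZMod.isCyclic_units_of_prime_pow p hp hp2 (k + 2)
  have htop : Subgroup.zpowers (ZMod.unitOfCoprime q (hqp.pow_right (k + 2))) = ⊤ := by
    refine zpowers_eq_top_of_zpowers_map_eq_top
      (ZMod.unitsMap_surjective (pow_dvd_pow p (Nat.le_add_left 2 k))) (fun r hr hrdvd => ?_)
      (hunitsMap (Nat.le_add_left 2 k) ▸ hgen)
    rw [Nat.card_eq_fintype_card, ZMod.card_units_eq_totient,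
      Nat.totient_prime_pow_succ hp] at hrdvd ⊢
    rw [pow_one]
    exact (hr.dvd_mul.1 hrdvd).elim (fun h => (hr.dvd_of_dvd_pow h).mul_right _)
      fun h => h.mul_left _
  rw [← hunitsMap (Nat.le_add_right k 2), ← MonoidHom.map_zpowers, htop,
    Subgroup.map_top_of_surjective _ (ZMod.unitsMap_surjective _)]

open Polynomial in
theorem irreducible_cyclotomic_prime_pow {p q : ℕ} [Fact q.Prime] (hp : p.Prime) (hp2 : p ≠ 2)
    {u : (ZMod (p ^ 2))ˣ} (hu : (u : ZMod (p ^ 2)) = q) (hgen : Subgroup.zpowers u = ⊤) (k : ℕ) :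
    Irreducible (cyclotomic (p ^ k) (ZMod q)) := by
  have hqp : q.Coprime p := by
    rw [← Nat.coprime_pow_right_iff two_pos, ← ZMod.isUnit_iff_coprime, ← hu]
    exact u.isUnit
  have hqk : ¬ q ∣ p ^ k := ((Fact.out : q.Prime).coprime_iff_not_dvd).1 (hqp.pow_right k)
  have := NeZero.mk (pow_ne_zero k hp.ne_zero)
  obtain rfl : u = ZMod.unitOfCoprime q (hqp.pow_right 2) := Units.ext hu
  refine ZMod.irreducible_of_dvd_cyclotomic_of_natDegree hqk dvd_rfl ?_
  rw [natDegree_cyclotomic, orderOf_eq_card_of_zpowers_eq_top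
    (zpowers_unitOfCoprime_prime_pow_eq_top hp hp2 hqp hgen k), Nat.card_eq_fintype_card,
    ZMod.card_units_eq_totient]

end Cyclotomic

section CyclicIdeal

open Polynomial

variable {F R : Type*} [Field F] [CommRing R] [Algebra F R] {e x : R} {Φ : F[X]}

theorem exists_algEquiv_quotient_torsionOf (hΦ : Irreducible Φ) (he : e ≠ 0)
    (hΦe : aeval x Φ * e = 0) (hx : ∀ y, ∃ f : F[X], aeval x f * e = y * e) :
    Nonempty ((F[X] ⧸ Ideal.span {Φ}) ≃ₐ[F] R ⧸ Ideal.torsionOf R R e) := by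
  let φ : F[X] →ₐ[F] R ⧸ Ideal.torsionOf R R e := (Ideal.Quotient.mkₐ F _).comp (aeval x)
  have hφ : Function.Surjective φ := by
    intro y
    obtain ⟨y, rfl⟩ := Ideal.Quotient.mk_surjective y
    obtain ⟨f, hf⟩ := hx y
    refine ⟨f, Ideal.Quotient.eq.2 ((Ideal.mem_torsionOf_iff _ _).2 ?_)⟩
    rw [smul_eq_mul, sub_mul, sub_eq_zero]
    exact hf
  have hker : RingHom.ker φ = Ideal.span {Φ} := by
    have : (Ideal.span {Φ}).IsMaximal := PrincipalIdealRing.isMaximal_of_irreducible hΦ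
    refine (this.eq_of_le ?_ ?_).symm
    · rw [Ideal.ne_top_iff_one, RingHom.mem_ker, map_one, ← map_one (Ideal.Quotient.mk _),
        Ideal.Quotient.eq_zero_iff_mem, Ideal.mem_torsionOf_iff, one_smul]
      exact he
    · rw [Ideal.span_singleton_le_iff_mem]
      exact Ideal.Quotient.eq_zero_iff_mem.2 ((Ideal.mem_torsionOf_iff _ _).2 hΦe)
  rw [← hker]
  exact ⟨Ideal.quotientKerAlgEquivOfSurjective hφ⟩

theorem isAtom_span_singleton_of_aeval_mul_eq_zero (hΦ : Irreducible Φ) (he : e ≠ 0)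
    (hΦe : aeval x Φ * e = 0) (hx : ∀ y, ∃ f : F[X], aeval x f * e = y * e) :
    IsAtom (Ideal.span {e}) := by
  obtain ⟨ψ⟩ := exists_algEquiv_quotient_torsionOf hΦ he hΦe hx
  have : (Ideal.span {Φ}).IsMaximal := PrincipalIdealRing.isMaximal_of_irreducible hΦ
  have hfield := ((Ideal.Quotient.maximal_ideal_iff_isField_quotient _).1 this)
  rw [← isSimpleModule_iff_isAtom, isSimpleModule_iff_quot_maximal]
  exact ⟨_, Ideal.Quotient.maximal_of_isField _ (ψ.symm.toMulEquiv.isField hfield),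
    ⟨(Ideal.quotTorsionOfEquivSpanSingleton R R e).symm⟩⟩

theorem finrank_span_singleton_of_aeval_mul_eq_zero (hΦ : Irreducible Φ) (he : e ≠ 0)
    (hΦe : aeval x Φ * e = 0) (hx : ∀ y, ∃ f : F[X], aeval x f * e = y * e) :
    Module.finrank F (Ideal.span {e}) = Φ.natDegree := by
  obtain ⟨ψ⟩ := exists_algEquiv_quotient_torsionOf hΦ he hΦe hx
  rw [← finrank_quotient_span_eq_natDegree, ψ.toLinearEquiv.finrank_eq]
  exact ((Ideal.quotTorsionOfEquivSpanSingleton R R e).restrictScalars F).finrank_eq.symm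

end CyclicIdeal

section GroupAlgebra

variable {F G : Type*} [Field F] [CommGroup G] {H K : Subgroup G} {y : MonoidAlgebra F G}

theorem finite_of_natCast_card_ne_zero {α : Type*} (hα : (Nat.card α : F) ≠ 0) : Finite α :=
  Nat.finite_of_card_ne_zero fun h => hα (by rw [h, Nat.cast_zero])

theorem natCast_card_subgroup_ne_zero (hG : (Nat.card G : F) ≠ 0) (H : Subgroup G) :
    (Nat.card H : F) ≠ 0 :=
  ne_zero_of_dvd_ne_zero hG (Nat.cast_dvd_cast H.card_subgroup_dvd_card)

theorem coeff_subgroupHat (H : Subgroup G) (g : G) :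
    (subgroupHat F H).coeff g = (H : Set G).indicator (fun _ => (Nat.card H : F)⁻¹) g := by
  rcases finite_or_infinite H with hH | hH
  · have := Fintype.ofFinite H
    simp only [subgroupHat, finsum_eq_sum_of_fintype, MonoidAlgebra.coeff_smul,
      MonoidAlgebra.coeff_sum, MonoidAlgebra.of_apply, MonoidAlgebra.coeff_single,
      Finsupp.smul_apply, Finsupp.finsetSum_apply, smul_eq_mul]
    by_cases hg : g ∈ H
    · rw [Set.indicator_of_mem (SetLike.mem_coe.2 hg), Finset.sum_eq_single ⟨g, hg⟩] <;>
        simp +contextual [Subtype.ext_iff]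
    · rw [Set.indicator_of_notMem (mt SetLike.mem_coe.1 hg), Finset.sum_eq_zero, mul_zero]
      exact fun h _ => Finsupp.single_eq_of_ne fun hgh => hg (hgh ▸ h.2)
  · simp [subgroupHat]

theorem of_mul_subgroupHat {g : G} (hg : g ∈ H) :
    MonoidAlgebra.of F G g * subgroupHat F H = subgroupHat F H := by
  ext x
  rw [MonoidAlgebra.of_apply, MonoidAlgebra.coeff_single_mul_apply, one_mul, coeff_subgroupHat,
    coeff_subgroupHat]
  exact Set.indicator_eq_indicator (H.mul_mem_cancel_left (H.inv_mem hg)) rfl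

theorem subgroupHat_mul_of_fixed (hH : (Nat.card H : F) ≠ 0)
    (hy : ∀ h ∈ H, MonoidAlgebra.of F G h * y = y) : subgroupHat F H * y = y := by
  have := finite_of_natCast_card_ne_zero hH
  have := Fintype.ofFinite H
  rw [subgroupHat, finsum_eq_sum_of_fintype, smul_mul_assoc, Finset.sum_mul,
    Finset.sum_congr rfl fun h _ => hy h.1 h.2, Finset.sum_const, Finset.card_univ,
    ← Nat.card_eq_fintype_card, ← Nat.cast_smul_eq_nsmul F, inv_smul_smul₀ hH]

theorem subgroupHat_mul_subgroupHat (hH : (Nat.card H : F) ≠ 0) (hHK : H ≤ K) :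
    subgroupHat F H * subgroupHat F K = subgroupHat F K :=
  subgroupHat_mul_of_fixed hH fun _ h => of_mul_subgroupHat (hHK h)

theorem hammingWeight_subgroupHat (hH : (Nat.card H : F) ≠ 0) :
    hammingWeight (subgroupHat F H) = Nat.card H := by
  rw [hammingWeight, ← Nat.card_eq_finsetCard]
  refine Nat.card_congr (Equiv.subtypeEquivRight fun g => ?_)
  simp [coeff_subgroupHat, hH]

theorem coeff_mul_of_fixed (hy : ∀ h ∈ H, MonoidAlgebra.of F G h * y = y) (g : G) {h : G}
    (hh : h ∈ H) : y.coeff (g * h) = y.coeff g := by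
  rw [mul_comm]
  simpa using congr(MonoidAlgebra.coeff $(hy h⁻¹ (inv_mem hh)) g)

theorem card_dvd_hammingWeight_of_fixed (hy : ∀ h ∈ H, MonoidAlgebra.of F G h * y = y) :
    Nat.card H ∣ hammingWeight y := by
  let S : Set G := y.coeff.support
  have hS : QuotientGroup.mk ⁻¹' ((↑) '' S : Set (G ⧸ H)) = S := by
    refine Set.Subset.antisymm ?_ (Set.subset_preimage_image _ _)
    rintro g ⟨s, hs, hsg⟩
    rw [Finset.mem_coe, Finsupp.mem_support_iff] at hs ⊢
    rwa [← mul_inv_cancel_left s g, coeff_mul_of_fixed hy s (QuotientGroup.eq.1 hsg)]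
  have hcard := Nat.card_congr (QuotientGroup.preimageMkEquivSubgroupProdSet H ((↑) '' S))
  rw [hS, Nat.card_prod] at hcard
  rw [hammingWeight, ← Nat.card_eq_finsetCard]
  exact ⟨_, hcard⟩

theorem two_mul_card_le_hammingWeight (hH : (Nat.card H : F) ≠ 0) (hy0 : y ≠ 0)
    (hy : ∀ h ∈ H, MonoidAlgebra.of F G h * y = y) (hsum : (y.coeff.sum fun _ r => r) = 0) :
    2 * Nat.card H ≤ hammingWeight y := by
  have := finite_of_natCast_card_ne_zero hH
  have := Fintype.ofFinite H
  obtain ⟨g, hg⟩ := Finsupp.ne_iff.1 (mt MonoidAlgebra.coeff_eq_zero.1 hy0)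
  let coset : Finset G :=
    Finset.univ.map ((Function.Embedding.subtype (· ∈ H)).trans (mulLeftEmbedding g))
  have hcoset : coset ⊆ y.coeff.support := by
    intro x hx
    obtain ⟨h, -, rfl⟩ := Finset.mem_map.1 hx
    exact Finsupp.mem_support_iff.2 ((coeff_mul_of_fixed hy g h.2).trans_ne hg)
  have hcard : coset.card = Nat.card H := by
    rw [Finset.card_map, Finset.card_univ, Nat.card_eq_fintype_card]
  -- If the support were a single coset of `H`, the coefficients would add up to `|H| * y(g) ≠ 0`.
  have hne : hammingWeight y ≠ Nat.card H := by
    intro heq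
    have hsupp := Finset.eq_of_subset_of_card_le hcoset (heq.trans hcard.symm).le
    have hconst : ∑ x ∈ coset, y.coeff x = Nat.card H • y.coeff g := by
      rw [← hcard]
      refine Finset.sum_eq_card_nsmul fun x hx => ?_
      obtain ⟨h, -, rfl⟩ := Finset.mem_map.1 hx
      exact coeff_mul_of_fixed hy g h.2
    rw [Finsupp.sum, ← hsupp, hconst, nsmul_eq_mul] at hsum
    exact (mul_ne_zero hH hg) hsum
  obtain ⟨m, hm⟩ := card_dvd_hammingWeight_of_fixed hy
  have hle : Nat.card H ≤ hammingWeight y := hcard ▸ Finset.card_le_card hcoset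
  have hm2 : 2 ≤ m := by
    by_contra! hm2
    interval_cases m <;> simp_all
  rw [hm, mul_comm]
  exact Nat.mul_le_mul_left _ hm2

theorem hammingWeight_sub_of_mul_le (g : G) :
    hammingWeight (y - MonoidAlgebra.of F G g * y) ≤ 2 * hammingWeight y := by
  classical
  have hmul : hammingWeight (MonoidAlgebra.of F G g * y) ≤ hammingWeight y :=
    (Finset.card_le_card (MonoidAlgebra.support_coeff_single_mul_subset _ _ _)).trans
      Finset.card_image_le
  rw [two_mul]
  refine (Finset.card_le_card (MonoidAlgebra.coeff_sub y _ ▸ Finsupp.support_sub)).trans ?_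
  exact (Finset.card_union_le _ _).trans (Nat.add_le_add_left hmul _)

theorem sum_coeff_eq_zero_of_subgroupHat_mul_eq_zero (hK : (Nat.card K : F) ≠ 0)
    (hy : subgroupHat F K * y = 0) : (y.coeff.sum fun _ r => r) = 0 := by
  have := finite_of_natCast_card_ne_zero hK
  have := Fintype.ofFinite K
  let augmentation : MonoidAlgebra F G →ₐ[F] F := MonoidAlgebra.lift F F G 1
  have hhat : augmentation (subgroupHat F K) = 1 := by
    rw [Nat.card_eq_fintype_card] at hK
    simp [subgroupHat, finsum_eq_sum_of_fintype, augmentation, hK]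
  have haug := congr(augmentation $hy)
  rw [map_mul, hhat, one_mul, map_zero, MonoidAlgebra.lift_apply] at haug
  simpa using haug

end GroupAlgebra

section ActionKernel

variable {F G : Type*} [Field F] [CommGroup G] {I : GroupCode F G}

/-- The kernel of the action of `G` on the code `I` by multiplication, encoded as the kernel of the
homomorphism from `G` to `F[G] ⧸ Ann(I)`; it is the complete invariant by which minimal codes are
classified. -/
noncomputable def actionKernel (I : GroupCode F G) : Subgroup G :=
  ((Ideal.Quotient.mk (Submodule.annihilator I)).toMonoidHom.comp (MonoidAlgebra.of F G)).ker

theorem mem_actionKernel {g : G} :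
    g ∈ actionKernel I ↔ ∀ y ∈ I, MonoidAlgebra.of F G g * y = y := by
  have hone : (1 : MonoidAlgebra F G ⧸ Submodule.annihilator I) = Ideal.Quotient.mk _ 1 := rfl
  refine MonoidHom.mem_ker.trans ?_
  simp only [MonoidHom.comp_apply, RingHom.toMonoidHom_eq_coe, MonoidHom.coe_coe, hone,
    Ideal.Quotient.eq, Submodule.mem_annihilator, smul_eq_mul, sub_mul, one_mul, sub_eq_zero]

theorem mem_actionKernel_span_singleton {e : MonoidAlgebra F G} {g : G} :
    g ∈ actionKernel (Ideal.span {e}) ↔ MonoidAlgebra.of F G g * e = e := by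
  refine mem_actionKernel.trans ⟨fun h => h e (Ideal.mem_span_singleton_self e), fun h y hy => ?_⟩
  obtain ⟨z, rfl⟩ := Ideal.mem_span_singleton'.1 hy
  rw [mul_left_comm, h]

theorem IsMinimalCode.isCyclic_quotient_actionKernel [Finite G] (hI : IsMinimalCode I) :
    IsCyclic (G ⧸ actionKernel I) := by
  have : IsSimpleModule (MonoidAlgebra F G) I := isSimpleModule_iff_isAtom.2 hI
  have : (Submodule.annihilator I).IsMaximal := IsSimpleModule.annihilator_isMaximal
  have : IsDomain (MonoidAlgebra F G ⧸ Submodule.annihilator I) := Ideal.Quotient.isDomain _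
  refine isCyclic_of_injective_ringHom (QuotientGroup.lift (actionKernel I) _ le_rfl) ?_
  rw [injective_iff_map_eq_one]
  intro x hx
  obtain ⟨g, rfl⟩ := QuotientGroup.mk_surjective x
  exact (QuotientGroup.eq_one_iff g).2 hx

end ActionKernel

section HatDiffCode

variable {F G : Type*} [Field F] [CommGroup G] {H K : Subgroup G}

/-- The code generated by `Ĥ - K̂`, meant for `H < K`. The minimal codes other than the one
generated by `Ĝ` are of this form, with `K / H` the subgroup of order `p` of a cyclic group
`G / H`. -/
noncomputable def hatDiffCode (F : Type*) {G : Type*} [Field F] [CommGroup G]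
    (H K : Subgroup G) : GroupCode F G :=
  Ideal.span {subgroupHat F H - subgroupHat F K}

theorem natCast_card_ne_zero_of_le (hK : (Nat.card K : F) ≠ 0) (hHK : H ≤ K) :
    (Nat.card H : F) ≠ 0 :=
  ne_zero_of_dvd_ne_zero hK (Nat.cast_dvd_cast (Subgroup.card_dvd_of_le hHK))

theorem actionKernel_hatDiffCode (hH : (Nat.card H : F) ≠ 0) (hHK : H < K) :
    actionKernel (hatDiffCode F H K) = H := by
  refine le_antisymm (fun g hg => ?_) fun g hg => mem_actionKernel_span_singleton.2 ?_
  · by_contra hgH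
    obtain ⟨t, htK, htH⟩ := SetLike.exists_of_lt hHK
    have hge := mem_actionKernel_span_singleton.1 hg
    set e := subgroupHat F H - subgroupHat F K with he
    have hperiod (x : G) : e.coeff (g * x) = e.coeff x := by
      simpa using congr(MonoidAlgebra.coeff $hge (g * x)).symm
    have hne : e.coeff 1 ≠ e.coeff t := by
      simp [he, coeff_subgroupHat, htK, htH, sub_eq_add_neg, hH]
    have hzero {x : G} (hx : x ∉ K) : e.coeff x = 0 := by
      have hxH : x ∉ H := fun h => hx (hHK.le h)
      simp [he, coeff_subgroupHat, hx, hxH]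
    apply hne
    rw [← hperiod 1, mul_one]
    by_cases hgK : g ∈ K
    · simp [he, coeff_subgroupHat, hgK, hgH, htK, htH]
    · rw [← hperiod t, hzero hgK, hzero ((K.mul_mem_cancel_right htK).not.2 hgK)]
  · rw [mul_sub, of_mul_subgroupHat hg, of_mul_subgroupHat (hHK.le hg)]

theorem subgroupHat_sub_subgroupHat_ne_zero (hH : (Nat.card H : F) ≠ 0) (hHK : H < K) :
    subgroupHat F H - subgroupHat F K ≠ 0 := by
  intro h
  obtain ⟨t, -, htH⟩ := SetLike.exists_of_lt hHK
  rw [← actionKernel_hatDiffCode hH hHK, hatDiffCode, mem_actionKernel_span_singleton, h] at htH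
  exact htH (mul_zero _)

theorem subgroupHat_mul_eq_zero_of_mem_hatDiffCode (hK : (Nat.card K : F) ≠ 0) (hHK : H ≤ K)
    {y : MonoidAlgebra F G} (hy : y ∈ hatDiffCode F H K) : subgroupHat F K * y = 0 := by
  obtain ⟨z, rfl⟩ := Ideal.mem_span_singleton'.1 hy
  rw [mul_left_comm, mul_sub, subgroupHat_mul_subgroupHat hK le_rfl, mul_comm _ (subgroupHat F H),
    subgroupHat_mul_subgroupHat (natCast_card_ne_zero_of_le hK hHK) hHK, sub_self, mul_zero]

theorem hasCodeWeight_hatDiffCode (hK : (Nat.card K : F) ≠ 0) (hHK : H < K) :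
    HasCodeWeight (hatDiffCode F H K) (2 * Nat.card H) := by
  have hH := natCast_card_ne_zero_of_le hK hHK.le
  have hlower {y : MonoidAlgebra F G} (hy : y ∈ hatDiffCode F H K) (hy0 : y ≠ 0) :
      2 * Nat.card H ≤ hammingWeight y := by
    refine two_mul_card_le_hammingWeight hH hy0 (fun h hh => ?_) <|
      sum_coeff_eq_zero_of_subgroupHat_mul_eq_zero hK <|
        subgroupHat_mul_eq_zero_of_mem_hatDiffCode hK hHK.le hy
    exact mem_actionKernel.1 ((actionKernel_hatDiffCode hH hHK).ge hh) y hy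
  obtain ⟨t, htK, htH⟩ := SetLike.exists_of_lt hHK
  set y := subgroupHat F H - MonoidAlgebra.of F G t * subgroupHat F H
  have hy : y = (1 - MonoidAlgebra.of F G t) * (subgroupHat F H - subgroupHat F K) := by
    rw [sub_mul, one_mul, mul_sub, of_mul_subgroupHat htK, sub_sub_sub_cancel_right]
  have hymem : y ∈ hatDiffCode F H K := Ideal.mem_span_singleton'.2 ⟨_, hy.symm⟩
  have hy0 : y ≠ 0 := by
    rw [hy, sub_mul, one_mul, sub_ne_zero, ne_comm, Ne, ← mem_actionKernel_span_singleton]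
    exact (actionKernel_hatDiffCode hH hHK).symm ▸ htH
  refine ⟨⟨y, hymem, hy0, (hlower hymem hy0).antisymm' ?_⟩, ?_⟩
  · rw [← hammingWeight_subgroupHat hH]
    exact hammingWeight_sub_of_mul_le t
  · rintro _ ⟨z, hz, hz0, rfl⟩
    exact hlower hz hz0

end HatDiffCode

section CyclicQuotient

variable {G : Type*} [CommGroup G] {p k : ℕ} {H : Subgroup G}

/-- The subgroup of the `p`-th roots of the elements of `H`, that is, the preimage in `G` of the
`p`-torsion of `G ⧸ H`; when `G ⧸ H` is a nontrivial cyclic `p`-group, it is the unique subgroup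
containing `H` with index `p`. -/
def pthRoots (p : ℕ) (H : Subgroup G) : Subgroup G :=
  H.comap (powMonoidHom p)

theorem mem_pthRoots {g : G} : g ∈ pthRoots p H ↔ g ^ p ∈ H :=
  Iff.rfl

theorem le_pthRoots : H ≤ pthRoots p H :=
  fun _ hg => H.pow_mem hg p

theorem exists_sup_zpowers_eq_top (H : Subgroup G) [IsCyclic (G ⧸ H)] :
    ∃ x : G, H ⊔ Subgroup.zpowers x = ⊤ ∧ ∀ m : ℤ, x ^ m ∈ H ↔ (H.index : ℤ) ∣ m := by
  obtain ⟨y, hy⟩ := IsCyclic.exists_generator (α := G ⧸ H)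
  obtain ⟨x, rfl⟩ := QuotientGroup.mk_surjective y
  refine ⟨x, (Subgroup.eq_top_iff' _).2 fun g => ?_, fun m => ?_⟩
  · obtain ⟨m, hm⟩ := Subgroup.mem_zpowers_iff.1 (hy g)
    rw [← QuotientGroup.mk_zpow, QuotientGroup.eq] at hm
    exact Subgroup.mem_sup.2 ⟨_, hm, x ^ m, ⟨m, rfl⟩, by rw [mul_comm, mul_inv_cancel_left]⟩
  · rw [Subgroup.index, ← orderOf_eq_card_of_forall_mem_zpowers hy, orderOf_dvd_iff_zpow_eq_one,
      ← QuotientGroup.mk_zpow, QuotientGroup.eq_one_iff]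

theorem index_pthRoots [IsCyclic (G ⧸ H)] (hp : p.Prime) (hH : H.index = p ^ (k + 1)) :
    (pthRoots p H).index = p ^ k := by
  have : Finite (G ⧸ H) :=
    Nat.finite_of_card_ne_zero (hH.trans_ne (pow_ne_zero _ hp.ne_zero))
  have hcomap :
      pthRoots p H = (powMonoidHom p : G ⧸ H →* G ⧸ H).ker.comap (QuotientGroup.mk' H) := by
    ext g
    rw [Subgroup.mem_comap, MonoidHom.mem_ker, QuotientGroup.mk'_apply, powMonoidHom_apply,
      ← QuotientGroup.mk_pow, QuotientGroup.eq_one_iff, mem_pthRoots]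
  rw [hcomap, Subgroup.index_comap_of_surjective _ (QuotientGroup.mk'_surjective H),
    IsCyclic.index_powMonoidHom_ker, ← Subgroup.index, hH,
    Nat.gcd_eq_right (dvd_pow_self p k.succ_ne_zero), pow_succ, Nat.mul_div_cancel _ hp.pos]

theorem relIndex_pthRoots [IsCyclic (G ⧸ H)] (hp : p.Prime) (hH : H.index = p ^ (k + 1)) :
    H.relIndex (pthRoots p H) = p := by
  have hmul := Subgroup.relIndex_mul_index (le_pthRoots (p := p) (H := H))
  rw [index_pthRoots hp hH, hH, pow_succ'] at hmul
  exact Nat.eq_of_mul_eq_mul_right (pow_pos hp.pos k) hmul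

theorem lt_pthRoots [IsCyclic (G ⧸ H)] (hp : p.Prime) (hH : H.index = p ^ (k + 1)) :
    H < pthRoots p H := by
  refine le_pthRoots.lt_of_ne (ne_of_apply_ne Subgroup.index ?_)
  rw [index_pthRoots hp hH, hH]
  exact (Nat.pow_right_injective hp.two_le).ne k.succ_ne_self

theorem pthRoots_le_sup_zpowers (hp : p.Prime) {x : G} (hx : H ⊔ Subgroup.zpowers x = ⊤)
    (hxH : ∀ m : ℤ, x ^ m ∈ H ↔ (p : ℤ) ^ (k + 1) ∣ m) :
    pthRoots p H ≤ H ⊔ Subgroup.zpowers (x ^ p ^ k) := by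
  intro g hg
  obtain ⟨h, hh, _, ⟨m, rfl⟩, rfl⟩ := Subgroup.mem_sup.1 (hx ▸ Subgroup.mem_top g)
  have hmem : x ^ (m * p) ∈ H := by
    rw [mem_pthRoots, mul_pow] at hg
    rw [zpow_mul, zpow_natCast]
    exact (H.mul_mem_cancel_left (H.pow_mem hh p)).1 hg
  rw [hxH, pow_succ] at hmem
  obtain ⟨m, rfl⟩ := Int.dvd_of_mul_dvd_mul_right (Nat.cast_ne_zero.2 hp.ne_zero) hmem
  refine Subgroup.mul_mem_sup hh ⟨m, ?_⟩
  simp only [← zpow_natCast, ← zpow_mul, Nat.cast_pow]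

end CyclicQuotient

section CocyclicCode

variable {F G : Type*} [Field F] [CommGroup G] {p k : ℕ} {H K : Subgroup G}

open Polynomial

theorem aeval_cyclotomic_mul_subgroupHat_sub_eq_zero (hp : p.Prime) (hK : (Nat.card K : F) ≠ 0)
    (hHK : H ≤ K) {x : G} (hKx : K ≤ H ⊔ Subgroup.zpowers (x ^ p ^ k)) (hxH : x ^ p ^ (k + 1) ∈ H) :
    aeval (MonoidAlgebra.of F G x) (cyclotomic (p ^ (k + 1)) F) *
      (subgroupHat F H - subgroupHat F K) = 0 := by
  have := Fact.mk hp
  set e := subgroupHat F H - subgroupHat F K with he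
  set Φx := aeval (MonoidAlgebra.of F G x) (cyclotomic (p ^ (k + 1)) F)
  have hHe {h : G} (hh : h ∈ H) : MonoidAlgebra.of F G h * e = e := by
    rw [he, mul_sub, of_mul_subgroupHat hh, of_mul_subgroupHat (hHK hh)]
  -- `Φ(T) * (T ^ p ^ k - 1) = T ^ p ^ (k + 1) - 1` kills `e` at `T = x`, so `Φ(x) * e` is fixed by
  -- `x ^ p ^ k`, hence by all of `K`; but `K̂` kills the ideal generated by `e`.
  have hK_le : K ≤ actionKernel (Ideal.span {Φx * e}) := by
    refine hKx.trans (sup_le (fun h hh => ?_) ((Subgroup.zpowers_le).2 ?_)) <;>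
      rw [mem_actionKernel_span_singleton]
    · rw [mul_left_comm, hHe hh]
    · have hΦ := congrArg (aeval (MonoidAlgebra.of F G x))
        (cyclotomic_prime_pow_mul_X_pow_sub_one F p k)
      simp only [map_mul, map_sub, map_pow, aeval_X, map_one] at hΦ
      rw [← sub_eq_zero, map_pow, ← sub_one_mul, ← mul_assoc, mul_comm _ Φx, hΦ, sub_one_mul,
        ← map_pow, hHe hxH, sub_self]
  rw [← subgroupHat_mul_of_fixed hK fun h hh => mem_actionKernel_span_singleton.1 (hK_le hh)]
  exact subgroupHat_mul_eq_zero_of_mem_hatDiffCode hK hHK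
    (Ideal.mul_mem_left _ _ (Ideal.mem_span_singleton_self e))

theorem exists_aeval_of_mul_eq [Finite G] {x : G} (hx : H ⊔ Subgroup.zpowers x = ⊤)
    {e : MonoidAlgebra F G} (he : ∀ h ∈ H, MonoidAlgebra.of F G h * e = e)
    (y : MonoidAlgebra F G) : ∃ f : F[X], aeval (MonoidAlgebra.of F G x) f * e = y * e := by
  induction y using MonoidAlgebra.induction_on with
  | of g =>
    obtain ⟨h, hh, v, hv, rfl⟩ := Subgroup.mem_sup.1 (hx ▸ Subgroup.mem_top g)
    obtain ⟨m, rfl⟩ := mem_powers_iff_mem_zpowers.2 hv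
    exact ⟨X ^ m, by rw [map_pow, aeval_X, map_mul, mul_right_comm, he h hh, mul_comm, map_pow]⟩
  | add y z hy hz =>
    obtain ⟨f, hf⟩ := hy
    obtain ⟨g, hg⟩ := hz
    exact ⟨f + g, by rw [map_add, add_mul, hf, hg, add_mul]⟩
  | smul r y hy =>
    obtain ⟨f, hf⟩ := hy
    exact ⟨r • f, by rw [map_smul, smul_mul_assoc, hf, smul_mul_assoc]⟩

theorem exists_aeval_cyclotomic_mul_subgroupHat_sub_eq_zero [IsCyclic (G ⧸ H)] (hp : p.Prime)
    (hG : (Nat.card G : F) ≠ 0) (hH : H.index = p ^ (k + 1)) :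
    ∃ x : MonoidAlgebra F G,
      aeval x (cyclotomic (p ^ (k + 1)) F) * (subgroupHat F H - subgroupHat F (pthRoots p H)) = 0 ∧
      ∀ y, ∃ f : F[X], aeval x f * (subgroupHat F H - subgroupHat F (pthRoots p H)) =
        y * (subgroupHat F H - subgroupHat F (pthRoots p H)) := by
  have := finite_of_natCast_card_ne_zero hG
  have hK := natCast_card_subgroup_ne_zero hG (pthRoots p H)
  obtain ⟨x, hx, hxH⟩ := exists_sup_zpowers_eq_top H
  simp only [hH, Nat.cast_pow] at hxH
  refine ⟨MonoidAlgebra.of F G x,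
    aeval_cyclotomic_mul_subgroupHat_sub_eq_zero hp hK le_pthRoots
      (pthRoots_le_sup_zpowers hp hx hxH) ?_,
    exists_aeval_of_mul_eq hx fun h hh => ?_⟩
  · exact_mod_cast (hxH (p ^ (k + 1))).2 dvd_rfl
  · rw [mul_sub, of_mul_subgroupHat hh, of_mul_subgroupHat (le_pthRoots hh)]

theorem isMinimalCode_hatDiffCode_pthRoots [IsCyclic (G ⧸ H)] (hp : p.Prime)
    (hG : (Nat.card G : F) ≠ 0) (hH : H.index = p ^ (k + 1))
    (hΦ : Irreducible (cyclotomic (p ^ (k + 1)) F)) :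
    IsMinimalCode (hatDiffCode F H (pthRoots p H)) := by
  obtain ⟨x, hx, hxy⟩ := exists_aeval_cyclotomic_mul_subgroupHat_sub_eq_zero hp hG hH
  exact isAtom_span_singleton_of_aeval_mul_eq_zero hΦ (subgroupHat_sub_subgroupHat_ne_zero
    (natCast_card_subgroup_ne_zero hG H) (lt_pthRoots hp hH)) hx hxy

theorem finrank_hatDiffCode_pthRoots [IsCyclic (G ⧸ H)] (hp : p.Prime)
    (hG : (Nat.card G : F) ≠ 0) (hH : H.index = p ^ (k + 1))
    (hΦ : Irreducible (cyclotomic (p ^ (k + 1)) F)) :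
    Module.finrank F (hatDiffCode F H (pthRoots p H)) = p ^ k * (p - 1) := by
  obtain ⟨x, hx, hxy⟩ := exists_aeval_cyclotomic_mul_subgroupHat_sub_eq_zero hp hG hH
  rw [hatDiffCode, finrank_span_singleton_of_aeval_mul_eq_zero hΦ
    (subgroupHat_sub_subgroupHat_ne_zero (natCast_card_subgroup_ne_zero hG H) (lt_pthRoots hp hH))
    hx hxy, natDegree_cyclotomic, Nat.totient_prime_pow_succ hp]

theorem subgroupHat_ne_zero (hH : (Nat.card H : F) ≠ 0) : subgroupHat F H ≠ 0 := by
  intro h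
  have := hammingWeight_subgroupHat hH
  rw [h, hammingWeight, MonoidAlgebra.coeff_zero, Finsupp.support_zero, Finset.card_empty] at this
  exact hH (this ▸ Nat.cast_zero)

theorem actionKernel_span_subgroupHat_top :
    actionKernel (Ideal.span {subgroupHat F (⊤ : Subgroup G)}) = ⊤ :=
  (Subgroup.eq_top_iff' _).2 fun g =>
    mem_actionKernel_span_singleton.2 (of_mul_subgroupHat (Subgroup.mem_top g))

theorem aeval_one_X_sub_one_mul (e : MonoidAlgebra F G) :
    aeval (1 : MonoidAlgebra F G) (X - C 1 : F[X]) * e = 0 := by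
  simp

theorem exists_aeval_one_mul_subgroupHat_top [Finite G] (y : MonoidAlgebra F G) :
    ∃ f : F[X], aeval (1 : MonoidAlgebra F G) f * subgroupHat F (⊤ : Subgroup G) =
      y * subgroupHat F (⊤ : Subgroup G) := by
  rw [← map_one (MonoidAlgebra.of F G)]
  exact exists_aeval_of_mul_eq (H := ⊤) (top_sup_eq _) (fun _ => of_mul_subgroupHat) y

theorem isMinimalCode_span_subgroupHat_top (hG : (Nat.card G : F) ≠ 0) :
    IsMinimalCode (Ideal.span {subgroupHat F (⊤ : Subgroup G)}) := by
  have := finite_of_natCast_card_ne_zero hG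
  exact isAtom_span_singleton_of_aeval_mul_eq_zero (irreducible_X_sub_C 1)
    (subgroupHat_ne_zero (natCast_card_subgroup_ne_zero hG ⊤)) (aeval_one_X_sub_one_mul _)
    exists_aeval_one_mul_subgroupHat_top

theorem finrank_span_subgroupHat_top (hG : (Nat.card G : F) ≠ 0) :
    Module.finrank F (Ideal.span {subgroupHat F (⊤ : Subgroup G)}) = 1 := by
  have := finite_of_natCast_card_ne_zero hG
  rw [finrank_span_singleton_of_aeval_mul_eq_zero (irreducible_X_sub_C 1)
    (subgroupHat_ne_zero (natCast_card_subgroup_ne_zero hG ⊤)) (aeval_one_X_sub_one_mul _)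
    exists_aeval_one_mul_subgroupHat_top, natDegree_X_sub_C]

theorem hasCodeWeight_span_subgroupHat_top (hG : (Nat.card G : F) ≠ 0) :
    HasCodeWeight (Ideal.span {subgroupHat F (⊤ : Subgroup G)}) (Nat.card G) := by
  have htop := natCast_card_subgroup_ne_zero hG ⊤
  refine ⟨⟨_, Ideal.mem_span_singleton_self _, subgroupHat_ne_zero htop,
    (hammingWeight_subgroupHat htop).trans Subgroup.card_top⟩, ?_⟩
  rintro _ ⟨y, hy, hy0, rfl⟩
  have hfixed (g : G) (hg : g ∈ (⊤ : Subgroup G)) : MonoidAlgebra.of F G g * y = y :=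
    mem_actionKernel.1 (actionKernel_span_subgroupHat_top.ge hg) y hy
  refine Nat.le_of_dvd ?_ (Subgroup.card_top (G := G) ▸ card_dvd_hammingWeight_of_fixed hfixed)
  exact Finset.card_pos.2
    (Finsupp.support_nonempty_iff.2 (mt MonoidAlgebra.coeff_eq_zero.1 hy0))

open Classical in
/-- The minimal code attached to a subgroup `H` of a finite abelian `p`-group `G` with `G ⧸ H`
cyclic: the code on which `G` acts with kernel `H`. -/
noncomputable def cocyclicCode (F : Type*) {G : Type*} [Field F] [CommGroup G] (p : ℕ)
    (H : Subgroup G) : GroupCode F G :=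
  if H = ⊤ then Ideal.span {subgroupHat F ⊤} else hatDiffCode F H (pthRoots p H)

theorem cocyclicCode_top : cocyclicCode F p (⊤ : Subgroup G) = Ideal.span {subgroupHat F ⊤} :=
  if_pos rfl

theorem cocyclicCode_of_ne_top (hH : H ≠ ⊤) :
    cocyclicCode F p H = hatDiffCode F H (pthRoots p H) :=
  if_neg hH

theorem exists_index_eq_prime_pow_succ [Finite G] [IsCyclic (G ⧸ H)] (hp : p.Prime)
    (hGp : IsPGroup p G) (hH : H ≠ ⊤) :
    ∃ k, H.index = p ^ (k + 1) ∧ p ^ (k + 1) ∣ Monoid.exponent G := by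
  have := Fact.mk hp
  obtain ⟨k, hk⟩ := hGp.index H
  have hdvd : H.index ∣ Monoid.exponent G := by
    rw [Subgroup.index, ← IsCyclic.exponent_eq_card]
    exact MonoidHom.exponent_dvd (QuotientGroup.mk'_surjective H)
  rw [hk] at hdvd
  cases k with
  | zero => exact absurd (Subgroup.index_eq_one.1 hk) hH
  | succ k => exact ⟨k, hk, hdvd⟩

theorem isMinimalCode_cocyclicCode [IsCyclic (G ⧸ H)] (hp : p.Prime) (hGp : IsPGroup p G)
    (hG : (Nat.card G : F) ≠ 0) (hΦ : ∀ d, d ∣ Monoid.exponent G → Irreducible (cyclotomic d F)) :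
    IsMinimalCode (cocyclicCode F p H) := by
  have := finite_of_natCast_card_ne_zero hG
  rcases eq_or_ne H ⊤ with rfl | hH
  · rw [cocyclicCode_top]
    exact isMinimalCode_span_subgroupHat_top hG
  · obtain ⟨k, hk, hkdvd⟩ := exists_index_eq_prime_pow_succ hp hGp hH
    rw [cocyclicCode_of_ne_top hH]
    exact isMinimalCode_hatDiffCode_pthRoots hp hG hk (hΦ _ hkdvd)

theorem actionKernel_cocyclicCode [IsCyclic (G ⧸ H)] (hp : p.Prime) (hGp : IsPGroup p G)
    (hG : (Nat.card G : F) ≠ 0) : actionKernel (cocyclicCode F p H) = H := by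
  have := finite_of_natCast_card_ne_zero hG
  rcases eq_or_ne H ⊤ with rfl | hH
  · rw [cocyclicCode_top, actionKernel_span_subgroupHat_top]
  · obtain ⟨k, hk, -⟩ := exists_index_eq_prime_pow_succ hp hGp hH
    rw [cocyclicCode_of_ne_top hH,
      actionKernel_hatDiffCode (natCast_card_subgroup_ne_zero hG H) (lt_pthRoots hp hk)]

theorem IsMinimalCode.exists_ne_zero_mem_cocyclicCode {I : GroupCode F G} (hI : IsMinimalCode I)
    (hp : p.Prime) (hGp : IsPGroup p G) (hG : (Nat.card G : F) ≠ 0) :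
    ∃ y ∈ I, y ≠ 0 ∧ y ∈ cocyclicCode F p (actionKernel I) := by
  have := finite_of_natCast_card_ne_zero hG
  have := hI.isCyclic_quotient_actionKernel
  have hcard := natCast_card_subgroup_ne_zero hG
  by_cases hH : actionKernel I = ⊤
  · obtain ⟨y, hy, hy0⟩ := Submodule.exists_mem_ne_zero_of_ne_bot hI.1
    refine ⟨y, hy, hy0, ?_⟩
    rw [hH, cocyclicCode_top, Ideal.mem_span_singleton']
    refine ⟨y, ?_⟩
    rw [mul_comm, subgroupHat_mul_of_fixed (hcard ⊤) fun g hg =>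
      mem_actionKernel.1 (hH.ge hg) y hy]
  · obtain ⟨k, hk, -⟩ := exists_index_eq_prime_pow_succ hp hGp hH
    obtain ⟨g, hgK, hgH⟩ := SetLike.exists_of_lt (lt_pthRoots hp hk)
    rw [mem_actionKernel] at hgH
    push Not at hgH
    obtain ⟨y, hy, hgy⟩ := hgH
    refine ⟨y - subgroupHat F (pthRoots p (actionKernel I)) * y,
      I.sub_mem hy (I.mul_mem_left _ hy), fun h0 => hgy ?_, ?_⟩
    · rw [sub_eq_zero.1 h0, ← mul_assoc, of_mul_subgroupHat hgK]
    · rw [cocyclicCode_of_ne_top hH]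
      refine Ideal.mem_span_singleton'.2 ⟨y, ?_⟩
      rw [mul_comm, sub_mul, subgroupHat_mul_of_fixed (hcard _) fun h hh =>
        mem_actionKernel.1 hh y hy]

theorem IsMinimalCode.eq_cocyclicCode {I : GroupCode F G} (hI : IsMinimalCode I)
    (hp : p.Prime) (hGp : IsPGroup p G) (hG : (Nat.card G : F) ≠ 0)
    (hΦ : ∀ d, d ∣ Monoid.exponent G → Irreducible (cyclotomic d F)) :
    I = cocyclicCode F p (actionKernel I) := by
  have := finite_of_natCast_card_ne_zero hG
  have := hI.isCyclic_quotient_actionKernel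
  obtain ⟨y, hyI, hy0, hy⟩ := hI.exists_ne_zero_mem_cocyclicCode hp hGp hG
  by_contra hne
  exact hy0 (Submodule.mem_bot _ |>.1 <|
    (hI.disjoint_of_ne (isMinimalCode_cocyclicCode hp hGp hG hΦ) hne).le_bot ⟨hyI, hy⟩)

theorem isMinimalCode_iff_exists_cocyclicCode {I : GroupCode F G} (hp : p.Prime)
    (hGp : IsPGroup p G) (hG : (Nat.card G : F) ≠ 0)
    (hΦ : ∀ d, d ∣ Monoid.exponent G → Irreducible (cyclotomic d F)) :
    IsMinimalCode I ↔ ∃ H : Subgroup G, IsCyclic (G ⧸ H) ∧ I = cocyclicCode F p H := by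
  have := finite_of_natCast_card_ne_zero hG
  constructor
  · exact fun hI => ⟨_, hI.isCyclic_quotient_actionKernel, hI.eq_cocyclicCode hp hGp hG hΦ⟩
  · rintro ⟨H, hH, rfl⟩
    exact isMinimalCode_cocyclicCode hp hGp hG hΦ

theorem IsMinimalCode.eq_of_actionKernel_eq {I J : GroupCode F G} (hI : IsMinimalCode I)
    (hJ : IsMinimalCode J) (hp : p.Prime) (hGp : IsPGroup p G) (hG : (Nat.card G : F) ≠ 0)
    (hΦ : ∀ d, d ∣ Monoid.exponent G → Irreducible (cyclotomic d F))
    (h : actionKernel I = actionKernel J) : I = J := by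
  rw [hI.eq_cocyclicCode hp hGp hG hΦ, hJ.eq_cocyclicCode hp hGp hG hΦ, h]

end CocyclicCode

section GEquivalence

variable {F G : Type*} [Field F] [CommGroup G] {p : ℕ} {I J : GroupCode F G}

theorem gEquivalent_iff_exists_comap_eq :
    GEquivalent I J ↔ ∃ ψ : G ≃* G, I.comap (MonoidAlgebra.domCongr F F ψ).symm = J :=
  exists_congr fun ψ => Iff.trans
    (Eq.congr_left ((MonoidAlgebra.domCongr F F ψ).toEquiv.image_eq_preimage_symm _))
    (SetLike.coe_set_eq (p := I.comap (MonoidAlgebra.domCongr F F ψ).symm))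

theorem actionKernel_comap_domCongr_symm (ψ : G ≃* G) (I : GroupCode F G) :
    actionKernel (I.comap (MonoidAlgebra.domCongr F F ψ).symm) =
      (actionKernel I).map ψ.toMonoidHom := by
  ext g
  rw [Subgroup.mem_map_equiv, mem_actionKernel, mem_actionKernel]
  refine (MonoidAlgebra.domCongr F F ψ).symm.toEquiv.forall_congr fun {y} => ?_
  rw [Ideal.mem_comap]
  refine imp_congr_right fun _ => ?_
  rw [← (MonoidAlgebra.domCongr F F ψ).symm.injective.eq_iff, map_mul]
  simp [MonoidAlgebra.domCongr_symm]

theorem IsMinimalCode.comap_domCongr_symm (hI : IsMinimalCode I) (ψ : G ≃* G) :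
    IsMinimalCode (I.comap (MonoidAlgebra.domCongr F F ψ).symm) :=
  ((MonoidAlgebra.domCongr F F ψ).symm.toRingEquiv.idealComapOrderIso.isAtom_iff I).2 hI

open Polynomial

theorem IsMinimalCode.gEquivalent_iff_exists_map_actionKernel_eq (hI : IsMinimalCode I)
    (hJ : IsMinimalCode J) (hp : p.Prime) (hGp : IsPGroup p G) (hG : (Nat.card G : F) ≠ 0)
    (hΦ : ∀ d, d ∣ Monoid.exponent G → Irreducible (cyclotomic d F)) :
    GEquivalent I J ↔ ∃ ψ : G ≃* G, (actionKernel I).map ψ.toMonoidHom = actionKernel J := by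
  rw [gEquivalent_iff_exists_comap_eq]
  refine exists_congr fun ψ => ?_
  rw [← actionKernel_comap_domCongr_symm]
  exact ⟨congrArg _, (hI.comap_domCongr_symm ψ).eq_of_actionKernel_eq hJ hp hGp hG hΦ⟩

theorem numMinimalCodeClasses_eq_card {ι : Type*} (R : ι → Subgroup G)
    [∀ r, IsCyclic (G ⧸ R r)] (hp : p.Prime) (hGp : IsPGroup p G) (hG : (Nat.card G : F) ≠ 0)
    (hΦ : ∀ d, d ∣ Monoid.exponent G → Irreducible (cyclotomic d F))
    (hinj : ∀ r s, (∃ ψ : G ≃* G, (R r).map ψ.toMonoidHom = R s) → r = s)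
    (hsurj : ∀ H : Subgroup G, IsCyclic (G ⧸ H) → ∃ r, ∃ ψ : G ≃* G, (R r).map ψ.toMonoidHom = H) :
    numMinimalCodeClasses F G = Nat.card ι := by
  have := finite_of_natCast_card_ne_zero hG
  have hmin r : IsMinimalCode (cocyclicCode F p (R r)) := isMinimalCode_cocyclicCode hp hGp hG hΦ
  let code (r : ι) : {I : GroupCode F G // IsMinimalCode I} := ⟨_, hmin r⟩
  have hcode r I : minimalCodeSetoid F G (code r) I ↔
      ∃ ψ : G ≃* G, (R r).map ψ.toMonoidHom = actionKernel I.1 := by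
    refine ((hmin r).gEquivalent_iff_exists_map_actionKernel_eq I.2 hp hGp hG hΦ).trans ?_
    rw [actionKernel_cocyclicCode hp hGp hG]
  refine (Nat.card_congr (Equiv.ofBijective (fun r => Quotient.mk _ (code r)) ⟨?_, ?_⟩)).symm
  · intro r s hrs
    have := (hcode r (code s)).1 (Quotient.exact hrs)
    rw [actionKernel_cocyclicCode hp hGp hG] at this
    exact hinj r s this
  · rintro ⟨I⟩
    obtain ⟨r, hr⟩ := hsurj _ I.2.isCyclic_quotient_actionKernel
    exact ⟨r, Quotient.sound ((hcode r I).2 hr)⟩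

end GEquivalence

section CommGroup

variable {G : Type*} [CommGroup G] {H K : Subgroup G} {x y : G}

theorem card_sup_of_disjoint (h : Disjoint H K) :
    Nat.card ↥(H ⊔ K) = Nat.card H * Nat.card K := by
  have hK : K.relIndex (H ⊔ K) = Nat.card H := by
    rw [Subgroup.relIndex_sup_right, ← Subgroup.inf_relIndex_left, h.eq_bot,
      Subgroup.relIndex_bot_left]
  rw [← Subgroup.relIndex_bot_left (H ⊔ K),
    ← Subgroup.relIndex_mul_relIndex ⊥ K (H ⊔ K) bot_le le_sup_right, hK,
    Subgroup.relIndex_bot_left, mul_comm]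

theorem orderOf_mul_of_disjoint_zpowers
    (h : Disjoint (Subgroup.zpowers x) (Subgroup.zpowers y)) :
    orderOf (x * y) = (orderOf x).lcm (orderOf y) := by
  refine Nat.dvd_antisymm (Commute.all x y).orderOf_mul_dvd_lcm ?_
  have hxy : x ^ orderOf (x * y) * y ^ orderOf (x * y) = 1 := by rw [← mul_pow, pow_orderOf_eq_one]
  obtain ⟨hx, hy⟩ := Subgroup.disjoint_iff_mul_eq_one.1 h (Subgroup.npow_mem_zpowers x _)
    (Subgroup.npow_mem_zpowers y _) hxy
  exact Nat.lcm_dvd (orderOf_dvd_of_pow_eq_one hx) (orderOf_dvd_of_pow_eq_one hy)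

theorem zpowers_pow_eq_of_coprime {i : ℕ} (hi : i.Coprime (orderOf x)) :
    Subgroup.zpowers (x ^ i) = Subgroup.zpowers x :=
  le_antisymm (Subgroup.zpowers_le.2 (Subgroup.npow_mem_zpowers x i)) <|
    Subgroup.zpowers_le.2 <| (mem_zpowers_pow_iff).2 hi

theorem exponent_of_zpowers_sup_eq_top (h : Subgroup.zpowers x ⊔ Subgroup.zpowers y = ⊤)
    (hyx : orderOf y ∣ orderOf x) : Monoid.exponent G = orderOf x := by
  have hker : ⊤ ≤ (powMonoidHom (orderOf x) : G →* G).ker := by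
    rw [← h, sup_le_iff, Subgroup.zpowers_le, Subgroup.zpowers_le]
    exact ⟨pow_orderOf_eq_one x, orderOf_dvd_iff_pow_eq_one.1 hyx⟩
  exact Nat.dvd_antisymm
    (Monoid.exponent_dvd_of_forall_pow_eq_one fun g => hker (Subgroup.mem_top g))
    (Monoid.order_dvd_exponent x)

theorem isCyclic_quotient_of_sup_zpowers_eq_top (h : H ⊔ Subgroup.zpowers x = ⊤) :
    IsCyclic (G ⧸ H) := by
  refine ⟨x, fun g => ?_⟩
  obtain ⟨g, rfl⟩ := QuotientGroup.mk_surjective g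
  obtain ⟨y, hy, _, ⟨m, rfl⟩, rfl⟩ := Subgroup.mem_sup.1 (h ▸ Subgroup.mem_top g)
  exact ⟨m, QuotientGroup.eq.2 (by simpa [mul_comm y] using hy)⟩

theorem index_dvd_of_forall_pow_mem [IsCyclic (G ⧸ H)] {m : ℕ} (h : ∀ g : G, g ^ m ∈ H) :
    H.index ∣ m := by
  obtain ⟨x, -, hx⟩ := exists_sup_zpowers_eq_top H
  exact Int.natCast_dvd_natCast.1 <| (hx m).1 <| by simpa using h x

theorem exists_mul_pow_mem_of_relIndex_eq_prime {p : ℕ} (hp : p.Prime) (hHK : H.relIndex K = p)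
    (hx : x ∈ K) (hxH : x ∉ H) (hy : y ∈ K) : ∃ i < p, y * x ^ i ∈ H := by
  have := Fact.mk hp
  have hcard : Nat.card (K ⧸ H.subgroupOf K) = p := hHK
  have hx1 : ((⟨x, hx⟩ : K) : K ⧸ H.subgroupOf K) ≠ 1 :=
    fun h => hxH ((QuotientGroup.eq_one_iff (⟨x, hx⟩ : K)).1 h)
  obtain ⟨m, hm⟩ : ((⟨y, hy⟩ : K) : K ⧸ H.subgroupOf K)⁻¹ ∈ Submonoid.powers _ :=
    mem_powers_of_prime_card hcard hx1
  dsimp only at hm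
  rw [← pow_mod_natCard, hcard, eq_inv_iff_mul_eq_one, mul_comm, ← QuotientGroup.mk_pow,
    ← QuotientGroup.mk_mul, QuotientGroup.eq_one_iff] at hm
  exact ⟨m % p, Nat.mod_lt m hp.pos, hm⟩

theorem exists_monoidHom_zpowers {G' : Type*} [Group G'] {x' : G'} (hx : orderOf x' ∣ orderOf x) :
    ∃ f : Subgroup.zpowers x →* G', f ⟨x, Subgroup.mem_zpowers x⟩ = x' := by
  have hgen (z : Subgroup.zpowers x) :
      z ∈ Subgroup.zpowers (⟨x, Subgroup.mem_zpowers x⟩ : Subgroup.zpowers x) := by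
    obtain ⟨_, m, rfl⟩ := z
    exact ⟨m, rfl⟩
  rw [← Subgroup.orderOf_mk x (Subgroup.mem_zpowers x)] at hx
  exact ⟨_, monoidHomOfForallMemZpowers_apply_gen hgen hx⟩

theorem exists_monoidHom_of_isCompl_zpowers {G' : Type*} [CommGroup G'] {x' y' : G'}
    (h : IsCompl (Subgroup.zpowers x) (Subgroup.zpowers y)) (hx : orderOf x' ∣ orderOf x)
    (hy : orderOf y' ∣ orderOf y) : ∃ f : G →* G', f x = x' ∧ f y = y' := by
  let γ : Subgroup.zpowers x × Subgroup.zpowers y →* G :=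
    (Subgroup.zpowers x).subtype.coprod (Subgroup.zpowers y).subtype
  have hγ : Function.Bijective γ := by
    refine ⟨Subgroup.mul_injective_of_disjoint h.disjoint, fun g => ?_⟩
    obtain ⟨u, hu, v, hv, rfl⟩ := Subgroup.mem_sup.1 (h.sup_eq_top ▸ Subgroup.mem_top g)
    exact ⟨(⟨u, hu⟩, ⟨v, hv⟩), rfl⟩
  let e := MulEquiv.ofBijective γ hγ
  have hex : e.symm x = (⟨x, Subgroup.mem_zpowers x⟩, 1) :=
    e.symm_apply_eq.2 (mul_one x).symm
  have hey : e.symm y = (1, ⟨y, Subgroup.mem_zpowers y⟩) :=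
    e.symm_apply_eq.2 (one_mul y).symm
  obtain ⟨f, hf⟩ := exists_monoidHom_zpowers hx
  obtain ⟨g, hg⟩ := exists_monoidHom_zpowers hy
  refine ⟨(f.coprod g).comp e.symm.toMonoidHom, ?_, ?_⟩
  · simp [hex, hf]
  · simp [hey, hg]

theorem exists_mulEquiv_of_isCompl_zpowers [Finite G] {x' y' : G}
    (h : IsCompl (Subgroup.zpowers x) (Subgroup.zpowers y)) (hx : orderOf x' ∣ orderOf x)
    (hy : orderOf y' ∣ orderOf y) (h' : Subgroup.zpowers x' ⊔ Subgroup.zpowers y' = ⊤) :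
    ∃ ψ : G ≃* G, ψ x = x' ∧ ψ y = y' := by
  obtain ⟨f, rfl, rfl⟩ := exists_monoidHom_of_isCompl_zpowers h hx hy
  have hsurj : Function.Surjective f := by
    rw [← MonoidHom.range_eq_top, eq_top_iff, ← h', sup_le_iff, Subgroup.zpowers_le,
      Subgroup.zpowers_le]
    exact ⟨⟨x, rfl⟩, ⟨y, rfl⟩⟩
  exact ⟨MulEquiv.ofBijective f ⟨Finite.injective_iff_surjective.2 hsurj, hsurj⟩, rfl, rfl⟩

end CommGroup

section RankTwo

variable {G : Type*} [CommGroup G] {p n k i : ℕ} {a b : G} {H : Subgroup G}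

/-- `G` is the internal direct product of the cyclic groups `⟨a⟩` of order `p ^ n` and `⟨b⟩` of
prime order `p`, so that `a`, `b` is a basis of an abelian group of type `(p ^ n, p)`. -/
structure IsBasisOfType (p n : ℕ) (a b : G) : Prop where
  prime : p.Prime
  orderOf_left : orderOf a = p ^ n
  orderOf_right : orderOf b = p
  isCompl : IsCompl (Subgroup.zpowers a) (Subgroup.zpowers b)

/-- The subgroup `⟨a ^ p ^ k⟩ × ⟨b⟩`. -/
def rectSubgroup (p : ℕ) (a b : G) (k : ℕ) : Subgroup G :=
  Subgroup.zpowers (a ^ p ^ k) ⊔ Subgroup.zpowers b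

/-- The cyclic subgroup `⟨a ^ p ^ (k - 1) * b ^ i⟩`, meant for `1 ≤ k`: the exponent `k - 1` is
chosen so that it has index `p ^ k`, like `rectSubgroup p a b k`. -/
def diagSubgroup (p : ℕ) (a b : G) (k i : ℕ) : Subgroup G :=
  Subgroup.zpowers (a ^ p ^ (k - 1) * b ^ i)

theorem zpowers_mul_sup_of_mem {x y : G} (hy : y ∈ H) :
    Subgroup.zpowers (x * y) ⊔ H = Subgroup.zpowers x ⊔ H := by
  refine le_antisymm (sup_le (Subgroup.zpowers_le.2 ?_) le_sup_right)
    (sup_le (Subgroup.zpowers_le.2 ?_) le_sup_right)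
  · exact Subgroup.mul_mem_sup (Subgroup.mem_zpowers x) hy
  · simpa using Subgroup.mul_mem_sup (Subgroup.mem_zpowers (x * y)) (H.inv_mem hy)

namespace IsBasisOfType

theorem card_eq (h : IsBasisOfType p n a b) : Nat.card G = p ^ (n + 1) := by
  rw [← Subgroup.card_top, ← h.isCompl.sup_eq_top, card_sup_of_disjoint h.isCompl.disjoint,
    Nat.card_zpowers, Nat.card_zpowers, h.orderOf_left, h.orderOf_right, pow_succ]

theorem finite (h : IsBasisOfType p n a b) : Finite G :=
  Nat.finite_of_card_ne_zero (h.card_eq.trans_ne (pow_ne_zero _ h.prime.ne_zero))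

theorem isPGroup (h : IsBasisOfType p n a b) : IsPGroup p G :=
  IsPGroup.of_card h.card_eq

theorem exponent_eq (h : IsBasisOfType p n a b) (hn : n ≠ 0) : Monoid.exponent G = p ^ n := by
  rw [← h.orderOf_left]
  refine exponent_of_zpowers_sup_eq_top h.isCompl.sup_eq_top ?_
  rw [h.orderOf_left, h.orderOf_right]
  exact dvd_pow_self p hn

theorem index_eq_of_card_eq (h : IsBasisOfType p n a b) (hkn : k ≤ n)
    (hH : Nat.card H = p ^ (n - k + 1)) : H.index = p ^ k := by
  refine Nat.eq_of_mul_eq_mul_left (pow_pos h.prime.pos (n - k + 1)) ?_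
  rw [← hH, H.card_mul_index, h.card_eq, hH, ← pow_add]
  congr 1
  omega

theorem eq_of_le_of_index_eq {K : Subgroup G} (h : IsBasisOfType p n a b) (hHK : H ≤ K)
    (hidx : H.index = K.index) : H = K := by
  have := h.finite
  by_contra hne
  exact (Subgroup.index_strictAnti (hHK.lt_of_ne hne)).ne' hidx

theorem orderOf_pow_left (h : IsBasisOfType p n a b) (hkn : k ≤ n) :
    orderOf (a ^ p ^ k) = p ^ (n - k) := by
  rw [orderOf_pow_of_dvd (pow_ne_zero k h.prime.ne_zero)
    (h.orderOf_left ▸ pow_dvd_pow p hkn), h.orderOf_left, Nat.pow_div hkn h.prime.pos]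

theorem disjoint_zpowers_pow (h : IsBasisOfType p n a b) (k i : ℕ) :
    Disjoint (Subgroup.zpowers (a ^ k)) (Subgroup.zpowers (b ^ i)) :=
  h.isCompl.disjoint.mono (Subgroup.zpowers_le.2 (Subgroup.npow_mem_zpowers a k))
    (Subgroup.zpowers_le.2 (Subgroup.npow_mem_zpowers b i))

theorem card_rectSubgroup (h : IsBasisOfType p n a b) (hkn : k ≤ n) :
    Nat.card (rectSubgroup p a b k) = p ^ (n - k + 1) := by
  have hdisj := h.disjoint_zpowers_pow (p ^ k) 1
  rw [pow_one] at hdisj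
  rw [rectSubgroup, card_sup_of_disjoint hdisj, Nat.card_zpowers, Nat.card_zpowers,
    h.orderOf_pow_left hkn, h.orderOf_right, pow_succ]

theorem card_diagSubgroup (h : IsBasisOfType p n a b) (hk : 1 ≤ k) (hkn : k ≤ n) (i : ℕ) :
    Nat.card (diagSubgroup p a b k i) = p ^ (n - k + 1) := by
  rw [diagSubgroup, Nat.card_zpowers,
    orderOf_mul_of_disjoint_zpowers (h.disjoint_zpowers_pow (p ^ (k - 1)) i),
    h.orderOf_pow_left (by omega), show n - (k - 1) = n - k + 1 by omega]
  refine Nat.lcm_eq_left ((orderOf_pow_dvd i).trans ?_)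
  rw [h.orderOf_right]
  exact dvd_pow_self p (n - k).succ_ne_zero

theorem index_rectSubgroup (h : IsBasisOfType p n a b) (hkn : k ≤ n) :
    (rectSubgroup p a b k).index = p ^ k :=
  h.index_eq_of_card_eq hkn (h.card_rectSubgroup hkn)

theorem index_diagSubgroup (h : IsBasisOfType p n a b) (hk : 1 ≤ k) (hkn : k ≤ n) (i : ℕ) :
    (diagSubgroup p a b k i).index = p ^ k :=
  h.index_eq_of_card_eq hkn (h.card_diagSubgroup hk hkn i)

theorem coprime_of_lt (h : IsBasisOfType p n a b) (hi : i ≠ 0) (hip : i < p) :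
    i.Coprime (orderOf b) := by
  rw [h.orderOf_right]
  exact (Nat.coprime_of_lt_prime hi hip h.prime).symm

theorem rectSubgroup_zero (h : IsBasisOfType p n a b) : rectSubgroup p a b 0 = ⊤ := by
  rw [rectSubgroup, pow_zero, pow_one, h.isCompl.sup_eq_top]

theorem isCyclic_quotient_rectSubgroup (h : IsBasisOfType p n a b) (k : ℕ) :
    IsCyclic (G ⧸ rectSubgroup p a b k) := by
  refine isCyclic_quotient_of_sup_zpowers_eq_top (x := a) (top_le_iff.1 ?_)
  rw [← h.isCompl.sup_eq_top]
  exact sup_le le_sup_right (le_sup_right.trans le_sup_left)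

theorem isCyclic_quotient_diagSubgroup (h : IsBasisOfType p n a b) (hip : i < p)
    (hik : i = 0 → k = 1) : IsCyclic (G ⧸ diagSubgroup p a b k i) := by
  rcases eq_or_ne i 0 with rfl | hi
  · refine isCyclic_quotient_of_sup_zpowers_eq_top (x := b) ?_
    simpa [diagSubgroup, hik rfl] using h.isCompl.sup_eq_top
  · refine isCyclic_quotient_of_sup_zpowers_eq_top (x := a) ?_
    rw [diagSubgroup, mul_comm, zpowers_mul_sup_of_mem (Subgroup.npow_mem_zpowers a _),
      zpowers_pow_eq_of_coprime (h.coprime_of_lt hi hip), sup_comm, h.isCompl.sup_eq_top]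

theorem pthRoots_eq_rectSubgroup [IsCyclic (G ⧸ H)] (h : IsBasisOfType p n a b) (hk : 1 ≤ k)
    (hkn : k ≤ n) (hH : H.index = p ^ k) : pthRoots p H = rectSubgroup p a b (k - 1) := by
  obtain ⟨k, rfl⟩ := Nat.exists_eq_add_of_le' hk
  refine (h.eq_of_le_of_index_eq (sup_le ?_ ?_) ?_).symm
  · rw [Subgroup.zpowers_le, mem_pthRoots, ← pow_mul, ← pow_succ, Nat.add_sub_cancel, ← hH]
    exact H.pow_index_mem a
  · rw [Subgroup.zpowers_le, mem_pthRoots, orderOf_dvd_iff_pow_eq_one.1 h.orderOf_right.dvd]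
    exact H.one_mem
  · rw [index_pthRoots h.prime hH, ← rectSubgroup, h.index_rectSubgroup (by omega),
      Nat.add_sub_cancel]

theorem ne_zero_of_isCyclic_quotient_diagSubgroup [IsCyclic (G ⧸ diagSubgroup p a b k i)]
    (h : IsBasisOfType p n a b) (hk : 2 ≤ k) (hkn : k ≤ n) : i ≠ 0 := by
  rintro rfl
  have hpow : ⊤ ≤ pthRoots (p ^ (k - 1)) (diagSubgroup p a b k 0) := by
    rw [← h.isCompl.sup_eq_top, sup_le_iff, Subgroup.zpowers_le, Subgroup.zpowers_le, mem_pthRoots,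
      mem_pthRoots]
    have hb : orderOf b ∣ p ^ (k - 1) := by
      rw [h.orderOf_right]
      exact dvd_pow_self p (by omega)
    constructor
    · simp [diagSubgroup]
    · rw [orderOf_dvd_iff_pow_eq_one.1 hb]
      exact Subgroup.one_mem _
  have hdvd := index_dvd_of_forall_pow_mem fun g => mem_pthRoots.1 (hpow (Subgroup.mem_top g))
  rw [h.index_diagSubgroup (by omega) hkn, Nat.pow_dvd_pow_iff_le_right h.prime.one_lt] at hdvd
  omega

theorem exists_index_eq [IsCyclic (G ⧸ H)] (h : IsBasisOfType p n a b) (hn : n ≠ 0)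
    (hH : H ≠ ⊤) :
    ∃ k, 1 ≤ k ∧ k ≤ n ∧ H.index = p ^ k := by
  have := h.finite
  obtain ⟨k, hk, hdvd⟩ := exists_index_eq_prime_pow_succ h.prime h.isPGroup hH
  rw [h.exponent_eq hn, Nat.pow_dvd_pow_iff_le_right h.prime.one_lt] at hdvd
  exact ⟨k + 1, Nat.le_add_left 1 k, hdvd, hk⟩

theorem eq_diagSubgroup_of_notMem [IsCyclic (G ⧸ H)] (h : IsBasisOfType p n a b) (hk : 1 ≤ k)
    (hkn : k ≤ n) (hH : H.index = p ^ k) (hbH : b ∉ H) :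
    ∃ i < p, (i = 0 → k = 1) ∧ H = diagSubgroup p a b k i := by
  have hrel : H.relIndex (rectSubgroup p a b (k - 1)) = p := by
    rw [← h.pthRoots_eq_rectSubgroup hk hkn hH]
    refine relIndex_pthRoots h.prime (k := k - 1) ?_
    rw [hH, Nat.sub_add_cancel hk]
  obtain ⟨i, hip, hi⟩ := exists_mul_pow_mem_of_relIndex_eq_prime h.prime hrel
    (Subgroup.mem_sup_right (Subgroup.mem_zpowers b)) hbH
    (Subgroup.mem_sup_left (Subgroup.mem_zpowers (a ^ p ^ (k - 1))))
  obtain rfl : diagSubgroup p a b k i = H :=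
    h.eq_of_le_of_index_eq (Subgroup.zpowers_le.2 hi)
      ((h.index_diagSubgroup hk hkn i).trans hH.symm)
  refine ⟨i, hip, fun hi0 => ?_, rfl⟩
  by_contra hk1
  exact h.ne_zero_of_isCyclic_quotient_diagSubgroup (by omega) hkn hi0

theorem isCyclic_quotient_iff (h : IsBasisOfType p n a b) (hn : n ≠ 0) :
    IsCyclic (G ⧸ H) ↔ H = ⊤ ∨ (∃ k, 1 ≤ k ∧ k ≤ n ∧ H = rectSubgroup p a b k) ∨
      ∃ k i, 1 ≤ k ∧ k ≤ n ∧ i < p ∧ (i = 0 → k = 1) ∧ H = diagSubgroup p a b k i := by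
  constructor
  · intro hcyc
    by_cases htop : H = ⊤
    · exact Or.inl htop
    obtain ⟨k, hk, hkn, hH⟩ := h.exists_index_eq hn htop
    by_cases hb : b ∈ H
    · refine Or.inr (Or.inl ⟨k, hk, hkn, (h.eq_of_le_of_index_eq (sup_le ?_ ?_) ?_).symm⟩)
      · exact Subgroup.zpowers_le.2 (hH ▸ H.pow_index_mem a)
      · exact Subgroup.zpowers_le.2 hb
      · exact (h.index_rectSubgroup hkn).trans hH.symm
    · obtain ⟨i, hip, hik, hdiag⟩ := h.eq_diagSubgroup_of_notMem hk hkn hH hb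
      exact Or.inr (Or.inr ⟨k, i, hk, hkn, hip, hik, hdiag⟩)
  · rintro (rfl | ⟨k, -, -, rfl⟩ | ⟨k, i, -, -, hip, hik, rfl⟩)
    · exact h.rectSubgroup_zero ▸ h.isCyclic_quotient_rectSubgroup 0
    · exact h.isCyclic_quotient_rectSubgroup k
    · exact h.isCyclic_quotient_diagSubgroup hip hik

theorem not_isCyclic_rectSubgroup (h : IsBasisOfType p n a b) (hkn : k < n) :
    ¬ IsCyclic (rectSubgroup p a b k) := by
  intro hcyc
  have hker : rectSubgroup p a b k ≤ (powMonoidHom (p ^ (n - k)) : G →* G).ker := by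
    rw [rectSubgroup, sup_le_iff, Subgroup.zpowers_le, Subgroup.zpowers_le, MonoidHom.mem_ker,
      MonoidHom.mem_ker, powMonoidHom_apply, powMonoidHom_apply, ← orderOf_dvd_iff_pow_eq_one,
      ← orderOf_dvd_iff_pow_eq_one, h.orderOf_pow_left hkn.le, h.orderOf_right]
    exact ⟨dvd_rfl, dvd_pow_self p (by omega)⟩
  obtain ⟨g, hg⟩ := IsCyclic.exists_ofOrder_eq_natCard (α := rectSubgroup p a b k)
  rw [← Subgroup.orderOf_coe, h.card_rectSubgroup hkn.le] at hg
  have hdvd : orderOf (g : G) ∣ p ^ (n - k) := orderOf_dvd_of_pow_eq_one (hker g.2)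
  rw [hg, Nat.pow_dvd_pow_iff_le_right h.prime.one_lt] at hdvd
  omega

theorem exists_map_rectSubgroup_eq_diagSubgroup (h : IsBasisOfType p n a b) (hn : n ≠ 0)
    (hi : i ≠ 0) (hip : i < p) :
    ∃ ψ : G ≃* G, (rectSubgroup p a b n).map ψ.toMonoidHom = diagSubgroup p a b n i := by
  have := h.finite
  have horder : orderOf (a ^ p ^ (n - 1) * b ^ i) ∣ orderOf b := by
    refine (Commute.all _ _).orderOf_mul_dvd_lcm.trans (Nat.lcm_dvd ?_ (orderOf_pow_dvd i))
    rw [h.orderOf_pow_left (Nat.sub_le n 1), h.orderOf_right,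
      Nat.sub_sub_self (Nat.one_le_iff_ne_zero.2 hn), pow_one]
  obtain ⟨ψ, -, hψb⟩ := exists_mulEquiv_of_isCompl_zpowers h.isCompl dvd_rfl horder <| by
    rw [sup_comm, mul_comm, zpowers_mul_sup_of_mem (Subgroup.npow_mem_zpowers a _),
      zpowers_pow_eq_of_coprime (h.coprime_of_lt hi hip), sup_comm, h.isCompl.sup_eq_top]
  refine ⟨ψ, ?_⟩
  simp [rectSubgroup, diagSubgroup, ← h.orderOf_left, hψb, pow_orderOf_eq_one]

theorem exists_map_diagSubgroup_one_eq (h : IsBasisOfType p n a b) (hi : i ≠ 0) (hip : i < p)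
    (k : ℕ) :
    ∃ ψ : G ≃* G, (diagSubgroup p a b k 1).map ψ.toMonoidHom = diagSubgroup p a b k i := by
  have := h.finite
  obtain ⟨ψ, hψa, hψb⟩ :=
    exists_mulEquiv_of_isCompl_zpowers h.isCompl dvd_rfl (orderOf_pow_dvd (x := b) i) <| by
      rw [zpowers_pow_eq_of_coprime (h.coprime_of_lt hi hip), h.isCompl.sup_eq_top]
  exact ⟨ψ, by simp [diagSubgroup, hψa, hψb]⟩

theorem exists_map_diagSubgroup_one_one_eq (h : IsBasisOfType p n a b) (hn : n ≠ 0) :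
    ∃ ψ : G ≃* G, (diagSubgroup p a b 1 1).map ψ.toMonoidHom = diagSubgroup p a b 1 0 := by
  have := h.finite
  have horder : orderOf (a * b⁻¹) ∣ orderOf a := by
    rw [h.orderOf_left, ← h.exponent_eq hn]
    exact Monoid.order_dvd_exponent _
  obtain ⟨ψ, hψa, hψb⟩ := exists_mulEquiv_of_isCompl_zpowers h.isCompl horder dvd_rfl <| by
    rw [zpowers_mul_sup_of_mem (Subgroup.inv_mem _ (Subgroup.mem_zpowers b)),
      h.isCompl.sup_eq_top]
  exact ⟨ψ, by simp [diagSubgroup, hψa, hψb]⟩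

theorem exists_map_rectSubgroup_one_eq (h : IsBasisOfType p 1 a b) :
    ∃ ψ : G ≃* G, (rectSubgroup p a b 1).map ψ.toMonoidHom = diagSubgroup p a b 1 0 := by
  have := h.finite
  have horder : orderOf a = orderOf b := by rw [h.orderOf_left, h.orderOf_right, pow_one]
  obtain ⟨ψ, -, hψb⟩ := exists_mulEquiv_of_isCompl_zpowers h.isCompl horder.symm.dvd horder.dvd
    (sup_comm _ _ |>.trans h.isCompl.sup_eq_top)
  have hap : a ^ p = 1 := orderOf_dvd_iff_pow_eq_one.1 (h.orderOf_left.trans (pow_one p)).dvd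
  exact ⟨ψ, by simp [rectSubgroup, diagSubgroup, hψb, hap]⟩

/-- Representatives of the orbits of `Aut G` on the subgroups with cyclic quotient, for a group `G`
with a basis `a`, `b` of type `(p ^ n, p)`. -/
def orbitRepresentative (p n : ℕ) (a b : G) : Fin (n + 1) ⊕ Fin (n - 1) → Subgroup G
  | .inl k => rectSubgroup p a b k
  | .inr k => diagSubgroup p a b (k + 1) 1

theorem isCyclic_quotient_orbitRepresentative (h : IsBasisOfType p n a b)
    (r : Fin (n + 1) ⊕ Fin (n - 1)) : IsCyclic (G ⧸ orbitRepresentative p n a b r) := by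
  rcases r with k | k
  · exact h.isCyclic_quotient_rectSubgroup k
  · exact h.isCyclic_quotient_diagSubgroup h.prime.one_lt fun h10 => absurd h10 one_ne_zero

theorem orbitRepresentative_injective (h : IsBasisOfType p n a b)
    {r s : Fin (n + 1) ⊕ Fin (n - 1)} {ψ : G ≃* G}
    (hψ : (orbitRepresentative p n a b r).map ψ.toMonoidHom = orbitRepresentative p n a b s) :
    r = s := by
  have hidx := (Subgroup.index_map_equiv _ ψ).symm.trans (congrArg Subgroup.index hψ)
  have hiso := ((orbitRepresentative p n a b r).equivMapOfInjective ψ.toMonoidHom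
    ψ.injective).trans (MulEquiv.subgroupCongr hψ)
  have hpow := Nat.pow_right_injective h.prime.two_le
  rcases r with k | k <;> rcases s with l | l <;>
    simp only [orbitRepresentative] at hidx hiso
  · rw [h.index_rectSubgroup (by omega), h.index_rectSubgroup (by omega)] at hidx
    exact congrArg Sum.inl (Fin.ext (hpow hidx))
  · rw [h.index_rectSubgroup (by omega), h.index_diagSubgroup (by omega) (by omega)] at hidx
    have := hpow hidx
    exact absurd (hiso.isCyclic.2 (Subgroup.isCyclic_zpowers _))
      (h.not_isCyclic_rectSubgroup (by omega))
  · rw [h.index_rectSubgroup (by omega), h.index_diagSubgroup (by omega) (by omega)] at hidx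
    have := hpow hidx
    exact absurd (hiso.isCyclic.1 (Subgroup.isCyclic_zpowers _))
      (h.not_isCyclic_rectSubgroup (by omega))
  · rw [h.index_diagSubgroup (by omega) (by omega),
      h.index_diagSubgroup (by omega) (by omega)] at hidx
    exact congrArg Sum.inr (Fin.ext (Nat.succ_injective (hpow hidx)))

theorem exists_map_orbitRepresentative_eq_diagSubgroup (h : IsBasisOfType p n a b) (hk : 1 ≤ k)
    (hkn : k ≤ n) (hip : i < p) (hik : i = 0 → k = 1) :
    ∃ r, ∃ ψ : G ≃* G,
      (orbitRepresentative p n a b r).map ψ.toMonoidHom = diagSubgroup p a b k i := by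
  have hn : n ≠ 0 := by omega
  rcases hkn.lt_or_eq with hkn | rfl
  · obtain ⟨k, rfl⟩ := Nat.exists_eq_add_of_le' hk
    refine ⟨.inr ⟨k, by omega⟩, ?_⟩
    rcases eq_or_ne i 0 with rfl | hi
    · obtain rfl : k = 0 := by simpa using hik rfl
      exact h.exists_map_diagSubgroup_one_one_eq hn
    · exact h.exists_map_diagSubgroup_one_eq hi hip (k + 1)
  · rcases eq_or_ne i 0 with rfl | hi
    · obtain rfl := hik rfl
      exact ⟨.inl 1, h.exists_map_rectSubgroup_one_eq⟩
    · exact ⟨.inl (Fin.last k), h.exists_map_rectSubgroup_eq_diagSubgroup hn hi hip⟩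

theorem exists_map_orbitRepresentative_eq [IsCyclic (G ⧸ H)] (h : IsBasisOfType p n a b)
    (hn : n ≠ 0) :
    ∃ r, ∃ ψ : G ≃* G, (orbitRepresentative p n a b r).map ψ.toMonoidHom = H := by
  have hrect {k : ℕ} (hkn : k ≤ n) : ∃ r, ∃ ψ : G ≃* G,
      (orbitRepresentative p n a b r).map ψ.toMonoidHom = rectSubgroup p a b k :=
    ⟨.inl ⟨k, Nat.lt_succ_of_le hkn⟩, MulEquiv.refl G, Subgroup.map_id _⟩
  obtain rfl | ⟨k, -, hkn, rfl⟩ | ⟨k, i, hk, hkn, hip, hik, rfl⟩ :=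
    (h.isCyclic_quotient_iff hn).1 ‹_›
  · exact h.rectSubgroup_zero ▸ hrect (Nat.zero_le n)
  · exact hrect hkn
  · exact h.exists_map_orbitRepresentative_eq_diagSubgroup hk hkn hip hik

end IsBasisOfType

end RankTwo

section MinimalCodes

variable {F G : Type*} [Field F] [CommGroup G] {p n k i : ℕ} {a b : G} {H : Subgroup G}

open Polynomial

namespace IsBasisOfType

theorem natCast_card_ne_zero (h : IsBasisOfType p n a b) (hpF : (p : F) ≠ 0) :
    (Nat.card G : F) ≠ 0 := by
  rw [h.card_eq, Nat.cast_pow]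
  exact pow_ne_zero _ hpF

theorem irreducible_cyclotomic_of_dvd_exponent (h : IsBasisOfType p n a b) (hn : n ≠ 0)
    (hΦ : Irreducible (cyclotomic (p ^ n) F)) {d : ℕ} (hd : d ∣ Monoid.exponent G) :
    Irreducible (cyclotomic d F) := by
  rw [h.exponent_eq hn] at hd
  obtain ⟨k, hkn, rfl⟩ := (Nat.dvd_prime_pow h.prime).1 hd
  exact cyclotomic_irreducible_pow_of_irreducible_pow h.prime hkn hΦ

theorem cocyclicCode_eq_hatDiffCode [IsCyclic (G ⧸ H)] (h : IsBasisOfType p n a b) (hk : 1 ≤ k)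
    (hkn : k ≤ n) (hH : H.index = p ^ k) :
    cocyclicCode F p H = hatDiffCode F H (rectSubgroup p a b (k - 1)) := by
  rw [← h.pthRoots_eq_rectSubgroup hk hkn hH, cocyclicCode_of_ne_top]
  rintro rfl
  rw [Subgroup.index_top] at hH
  exact (Nat.one_lt_pow (by omega) h.prime.one_lt).ne hH

theorem finrank_and_hasCodeWeight_hatDiffCode [IsCyclic (G ⧸ H)] (h : IsBasisOfType p n a b)
    (hpF : (p : F) ≠ 0) (hΦ : Irreducible (cyclotomic (p ^ n) F)) (hk : 1 ≤ k) (hkn : k ≤ n)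
    (hH : H.index = p ^ k) :
    Module.finrank F (hatDiffCode F H (rectSubgroup p a b (k - 1))) = p ^ (k - 1) * (p - 1) ∧
      HasCodeWeight (hatDiffCode F H (rectSubgroup p a b (k - 1))) (2 * Nat.card H) := by
  have hG : (Nat.card G : F) ≠ 0 := h.natCast_card_ne_zero hpF
  rw [← h.pthRoots_eq_rectSubgroup hk hkn hH]
  obtain ⟨k, rfl⟩ := Nat.exists_eq_add_of_le' hk
  exact ⟨finrank_hatDiffCode_pthRoots h.prime hG hH
      (cyclotomic_irreducible_pow_of_irreducible_pow h.prime hkn hΦ),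
    hasCodeWeight_hatDiffCode (natCast_card_subgroup_ne_zero hG _) (lt_pthRoots h.prime hH)⟩

theorem isMinimalCode_iff (h : IsBasisOfType p n a b) (hn : n ≠ 0) (hpF : (p : F) ≠ 0)
    (hΦ : Irreducible (cyclotomic (p ^ n) F)) {I : GroupCode F G} :
    IsMinimalCode I ↔
      I = Ideal.span {subgroupHat F ⊤} ∨
      (∃ k, 1 ≤ k ∧ k ≤ n ∧
        I = hatDiffCode F (rectSubgroup p a b k) (rectSubgroup p a b (k - 1))) ∨
      ∃ k i, 1 ≤ k ∧ k ≤ n ∧ i < p ∧ (i = 0 → k = 1) ∧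
        I = hatDiffCode F (diagSubgroup p a b k i) (rectSubgroup p a b (k - 1)) := by
  have hrect (k : ℕ) (hk : 1 ≤ k) (hkn : k ≤ n) :
      cocyclicCode F p (rectSubgroup p a b k) =
        hatDiffCode F (rectSubgroup p a b k) (rectSubgroup p a b (k - 1)) :=
    have := h.isCyclic_quotient_rectSubgroup k
    h.cocyclicCode_eq_hatDiffCode hk hkn (h.index_rectSubgroup hkn)
  have hdiag (k i : ℕ) (hk : 1 ≤ k) (hkn : k ≤ n) (hip : i < p) (hik : i = 0 → k = 1) :
      cocyclicCode F p (diagSubgroup p a b k i) =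
        hatDiffCode F (diagSubgroup p a b k i) (rectSubgroup p a b (k - 1)) :=
    have := h.isCyclic_quotient_diagSubgroup hip hik
    h.cocyclicCode_eq_hatDiffCode hk hkn (h.index_diagSubgroup hk hkn i)
  simp only [isMinimalCode_iff_exists_cocyclicCode h.prime h.isPGroup (h.natCast_card_ne_zero hpF)
    fun _ => h.irreducible_cyclotomic_of_dvd_exponent hn hΦ, h.isCyclic_quotient_iff hn]
  constructor
  · rintro ⟨_, rfl | ⟨k, hk, hkn, rfl⟩ | ⟨k, i, hk, hkn, hip, hik, rfl⟩, rfl⟩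
    · exact Or.inl cocyclicCode_top
    · exact Or.inr (Or.inl ⟨k, hk, hkn, hrect k hk hkn⟩)
    · exact Or.inr (Or.inr ⟨k, i, hk, hkn, hip, hik, hdiag k i hk hkn hip hik⟩)
  · rintro (rfl | ⟨k, hk, hkn, rfl⟩ | ⟨k, i, hk, hkn, hip, hik, rfl⟩)
    · exact ⟨⊤, Or.inl rfl, cocyclicCode_top.symm⟩
    · exact ⟨_, Or.inr (Or.inl ⟨k, hk, hkn, rfl⟩), (hrect k hk hkn).symm⟩
    · exact ⟨_, Or.inr (Or.inr ⟨k, i, hk, hkn, hip, hik, rfl⟩), (hdiag k i hk hkn hip hik).symm⟩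

theorem numMinimalCodeClasses_eq (h : IsBasisOfType p n a b) (hn : n ≠ 0) (hpF : (p : F) ≠ 0)
    (hΦ : Irreducible (cyclotomic (p ^ n) F)) : numMinimalCodeClasses F G = 2 * n := by
  have := h.isCyclic_quotient_orbitRepresentative
  rw [numMinimalCodeClasses_eq_card (orbitRepresentative p n a b) h.prime h.isPGroup
    (h.natCast_card_ne_zero hpF) (fun _ => h.irreducible_cyclotomic_of_dvd_exponent hn hΦ)
    (fun _ _ ⟨_, hψ⟩ => h.orbitRepresentative_injective hψ)
    fun _ _ => h.exists_map_orbitRepresentative_eq hn, Nat.card_sum, Nat.card_fin, Nat.card_fin]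
  omega

theorem card_divisors_exponent (h : IsBasisOfType p n a b) (hn : n ≠ 0) :
    (Monoid.exponent G).divisors.card = n + 1 := by
  rw [h.exponent_eq hn, Nat.divisors_prime_pow h.prime, Finset.card_map, Finset.card_range]

end IsBasisOfType

theorem exists_diag_index_iff {P : ℕ → ℕ → Prop} (hn : n ≠ 0) :
    (∃ k i, 1 ≤ k ∧ k ≤ n ∧ i < p ∧ (i = 0 → k = 1) ∧ P k i) ↔
      (∃ i, i < p ∧ P 1 i) ∨ ∃ k i, 2 ≤ k ∧ k ≤ n ∧ 1 ≤ i ∧ i < p ∧ P k i := by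
  constructor
  · rintro ⟨k, i, hk, hkn, hip, hik, hP⟩
    rcases hk.eq_or_lt with rfl | hk
    · exact Or.inl ⟨i, hip, hP⟩
    · exact Or.inr ⟨k, i, hk, hkn, by omega, hip, hP⟩
  · rintro (⟨i, hip, hP⟩ | ⟨k, i, hk, hkn, hi, hip, hP⟩)
    · exact ⟨1, i, le_rfl, by omega, hip, fun _ => rfl, hP⟩
    · exact ⟨k, i, by omega, hkn, hip, by omega, hP⟩

end MinimalCodes

theorem mainTheorem8_general {F G : Type*} [Field F] [CommGroup G] {n p : ℕ} (hn : n ≠ 0)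
    (hp : p.Prime) (hpF : (p : F) ≠ 0) (hΦ : Irreducible (Polynomial.cyclotomic (p ^ n) F))
    {a b : G} (ha : orderOf a = p ^ n) (hb : orderOf b = p)
    (hab : IsCompl (Subgroup.zpowers a) (Subgroup.zpowers b)) :
    (∀ I : GroupCode F G, IsMinimalCode I ↔
      I = Ideal.span {subgroupHat F ⊤} ∨
      (∃ k, 1 ≤ k ∧ k ≤ n ∧
        I = hatDiffCode F (rectSubgroup p a b k) (rectSubgroup p a b (k - 1))) ∨
      (∃ i, i < p ∧ I = hatDiffCode F (diagSubgroup p a b 1 i) (rectSubgroup p a b 0)) ∨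
      (∃ k i, 2 ≤ k ∧ k ≤ n ∧ 1 ≤ i ∧ i < p ∧
        I = hatDiffCode F (diagSubgroup p a b k i) (rectSubgroup p a b (k - 1)))) ∧
    (Module.finrank F (Ideal.span {subgroupHat F (⊤ : Subgroup G)}) = 1 ∧
      HasCodeWeight (Ideal.span {subgroupHat F (⊤ : Subgroup G)}) (p ^ (n + 1))) ∧
    (∀ k, 1 ≤ k → k ≤ n →
      Module.finrank F (hatDiffCode F (rectSubgroup p a b k) (rectSubgroup p a b (k - 1))) =
        p ^ (k - 1) * (p - 1) ∧
      HasCodeWeight (hatDiffCode F (rectSubgroup p a b k) (rectSubgroup p a b (k - 1)))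
        (2 * p ^ (n - k + 1))) ∧
    (∀ i, i < p →
      Module.finrank F (hatDiffCode F (diagSubgroup p a b 1 i) (rectSubgroup p a b 0)) =
        p - 1 ∧
      HasCodeWeight (hatDiffCode F (diagSubgroup p a b 1 i) (rectSubgroup p a b 0))
        (2 * p ^ n)) ∧
    (∀ k i, 2 ≤ k → k ≤ n → 1 ≤ i → i < p →
      Module.finrank F (hatDiffCode F (diagSubgroup p a b k i) (rectSubgroup p a b (k - 1))) =
        p ^ (k - 1) * (p - 1) ∧
      HasCodeWeight (hatDiffCode F (diagSubgroup p a b k i) (rectSubgroup p a b (k - 1)))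
        (2 * p ^ (n - k + 1))) ∧
    numMinimalCodeClasses F G = 2 * n ∧ Finite G ∧ Nat.card G = p ^ (n + 1) ∧
    (Monoid.exponent G).divisors.card = n + 1 := by
  have h : IsBasisOfType p n a b := ⟨hp, ha, hb, hab⟩
  have hG : (Nat.card G : F) ≠ 0 := h.natCast_card_ne_zero hpF
  have hdiag {k i : ℕ} (hk : 1 ≤ k) (hkn : k ≤ n) (hip : i < p) (hik : i = 0 → k = 1) :
      Module.finrank F (hatDiffCode F (diagSubgroup p a b k i) (rectSubgroup p a b (k - 1))) =
        p ^ (k - 1) * (p - 1) ∧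
      HasCodeWeight (hatDiffCode F (diagSubgroup p a b k i) (rectSubgroup p a b (k - 1)))
        (2 * p ^ (n - k + 1)) :=
    have := h.isCyclic_quotient_diagSubgroup hip hik
    h.card_diagSubgroup hk hkn i ▸
      h.finrank_and_hasCodeWeight_hatDiffCode hpF hΦ hk hkn (h.index_diagSubgroup hk hkn i)
  refine ⟨fun I => (h.isMinimalCode_iff hn hpF hΦ).trans <|
      or_congr_right <| or_congr_right <| exists_diag_index_iff hn,
    ⟨finrank_span_subgroupHat_top hG, h.card_eq ▸ hasCodeWeight_span_subgroupHat_top hG⟩,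
    fun k hk hkn => ?_, fun i hip => ?_, fun k i hk hkn hi hip => ?_,
    h.numMinimalCodeClasses_eq hn hpF hΦ, h.finite, h.card_eq, h.card_divisors_exponent hn⟩
  · have := h.isCyclic_quotient_rectSubgroup k
    exact h.card_rectSubgroup hkn ▸
      h.finrank_and_hasCodeWeight_hatDiffCode hpF hΦ hk hkn (h.index_rectSubgroup hkn)
  · have hn1 : 1 ≤ n := Nat.one_le_iff_ne_zero.2 hn
    simpa [Nat.sub_add_cancel hn1] using hdiag le_rfl hn1 hip fun _ => rfl
  · exact hdiag (by omega) hkn hip (by omega)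

theorem mainTheorem8 {G : Type*} [CommGroup G] (n p : ℕ) (hn : 3 ≤ n)
    (hp : p.Prime) (hodd : Odd p)
    -- the class of `2` generates the group of units of `ℤ/p²`
    (u : (ZMod (p ^ 2))ˣ) (hu : (u : ZMod (p ^ 2)) = 2) (hgen : Subgroup.zpowers u = ⊤)
    -- `G` is the internal direct product of `⟨a⟩` and `⟨b⟩`
    (a b : G) (ha : orderOf a = p ^ n) (hb : orderOf b = p)
    (hab : IsCompl (Subgroup.zpowers a) (Subgroup.zpowers b)) :
    -- the minimal codes
    (∀ I : GroupCode (ZMod 2) G, IsMinimalCode I ↔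
      I = codeZero G ∨
      (∃ k, 1 ≤ k ∧ k ≤ n ∧ I = codeK p a b k) ∨
      (∃ i, i < p ∧ I = codeKI p a b 1 i) ∨
      (∃ k i, 2 ≤ k ∧ k ≤ n ∧ 1 ≤ i ∧ i < p ∧ I = codeKI p a b k i)) ∧
    -- their dimensions and weights
    (Module.finrank (ZMod 2) (codeZero G) = 1 ∧ HasCodeWeight (codeZero G) (p ^ (n + 1))) ∧
    (∀ k, 1 ≤ k → k ≤ n →
      Module.finrank (ZMod 2) (codeK p a b k) = p ^ (k - 1) * (p - 1) ∧
      HasCodeWeight (codeK p a b k) (2 * p ^ (n - k + 1))) ∧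
    (∀ i, i < p →
      Module.finrank (ZMod 2) (codeKI p a b 1 i) = p - 1 ∧
      HasCodeWeight (codeKI p a b 1 i) (2 * p ^ n)) ∧
    (∀ k i, 2 ≤ k → k ≤ n → 1 ≤ i → i < p →
      Module.finrank (ZMod 2) (codeKI p a b k i) = p ^ (k - 1) * (p - 1) ∧
      HasCodeWeight (codeKI p a b k i) (2 * p ^ (n - k + 1))) ∧
    -- the number of `G`-equivalence classes
    numMinimalCodeClasses (ZMod 2) G = 2 * n ∧
    -- `G` has odd order, but this number is not the number of divisors of its exponent
    Finite G ∧ Odd (Nat.card G) ∧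
    numMinimalCodeClasses (ZMod 2) G ≠ (Monoid.exponent G).divisors.card := by
  have hp2 : p ≠ 2 := by
    rintro rfl
    exact absurd hodd (by decide)
  have hpF : (p : ZMod 2) ≠ 0 := ZMod.natCast_ne_zero_iff_odd.2 hodd
  obtain ⟨hcodes, hzero, hrect, hdiagOne, hdiag, hnum, hfin, hcard, hdiv⟩ :=
    mainTheorem8_general (by omega) hp hpF
      (irreducible_cyclotomic_prime_pow (q := 2) hp hp2 hu hgen n) ha hb hab
  exact ⟨hcodes, hzero, hrect, hdiagOne, hdiag, hnum, hfin, hcard ▸ hodd.pow, by omega⟩
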